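/- Let $(\phi_j)_{j\ge1}$ be an orthonormal system in the real space $L_2(0,1)$. For $\varepsilon>0$ a signal $S\in L_2(0,1)$ is observed in Gaussian white noise, $dY_\varepsilon(t)=S(t)\,dt+\varepsilon\,dw(t)$, through the coefficients $y_j=\theta_j+\varepsilon\xi_j$, $j\ge 1$, where $\theta_j=\int_0^1 S\phi_j\,dt$ and $\xi_j$ are independent standard normal variables. For given real $\varkappa_{\varepsilon j}$ with $\rho_\varepsilon^2=\sum_j\varkappa_{\varepsilon j}^2<\infty$ put $$T_\varepsilon=\varepsilon^{-2}\sum_{j}\varkappa_{\varepsilon j}^2y_j^2-\rho_\varepsilon^2,\qquad A_\varepsilon=\varepsilon^{-4}\sum_j\varkappa_{\varepsilon j}^4,\qquad B_\varepsilon(S)=\frac{\varepsilon^{-4}\sum_j\varkappa_{\varepsilon j}^2\theta_j^2}{(2A_\varepsilon)^{1/2}},$$ $k_\varepsilon=\sup\{k\ge1:\sum_{j<k}\varkappa_{\varepsilon j}^2\le\frac12\rho_\varepsilon^2\}$ and $\varkappa_\varepsilon^2=\varkappa_{\varepsilon k_\varepsilon}^2$. The test $L_\varepsilon$ with threshold $x_\varepsilon\in\mathbb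 R$ rejects the hypothesis $S=0$ when $\varepsilon^{-2}(2A_\varepsilon)^{-1/2}T_\varepsilon>x_\varepsilon$; $\alpha(L_\varepsilon)$ is its type I error probability (at $S=0$) and $\beta(L_\varepsilon,S)$ its type II error probability at the alternative $S$. Only tests of this form, with $0<\alpha(L_\varepsilon)<1$ for all small $\varepsilon$, are considered. Throughout, $a_\varepsilon\asymp b_\varepsilon$ means that $a_\varepsilon/b_\varepsilon$ lies between two positive constants for all small $\varepsilon>0$. Assume: A1. For each $\varepsilon>0$ the sequence $(\varkappa_{\varepsilon j}^2)_j$ is non-increasing. A2. $C_1<A_\varepsilon<C_2$ for all $\varepsilon>0$, with constants $0<C_1<C_2$. A3. There are $C>0$ and $\lambda>1$ such that $\varkappa^2_{\varepsilon,[(1+\delta)k_\varepsilon]}<C(1+\delta)^{-\lambda}\varkappa_\varepsilon^2$ for all $\delta>0$, $\varepsilon>0$. A4. $\varkappa_{\varepsilon1}^2\asymp\varkappa_\varepsilon^2$; and for every $c>1$ there is $C>0$ with $\varkappa^2_{\varepsilon,[ck_\varepsilon]}\ge C\varkappa_\varepsilon^2$ for all $\varepsilon>0$. Let $0<r<1/2$,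 $0<2\omega<1-2r$ and $k_\varepsilon\asymp\varepsilon^{-4+8r+4\omega}$. A family $S_\varepsilon$ is called $\varepsilon^{-2\omega}$-LD consistent if for all tests $L_\varepsilon$ with $\varepsilon^{4\omega}\log\alpha(L_\varepsilon)\to0$ as $\varepsilon\to0$ there is $c>0$ with $|\log\beta(L_\varepsilon,S_\varepsilon)|\ge c\,\varepsilon^{-4\omega}$ for all small $\varepsilon$; consistency along a sequence $\varepsilon_n\to0$ is defined in the same way, with $\varepsilon$ restricted to the sequence. The family is called $\varepsilon^{-2\omega}$-LD inconsistent if it is not consistent along any sequence $\varepsilon_n\to0$, $\varepsilon_n>0$. **Theorem.** Let $S_\varepsilon$ be $\varepsilon^{-2\omega}$-LD consistent and $S_{1\varepsilon}$ be $\varepsilon^{-2\omega}$-LD inconsistent, $\|S_\varepsilon\|\asymp\varepsilon^{2r}$, $\|S_{1\varepsilon}\|\asymp\varepsilon^{2r}$. Then for all tests $L_\varepsilon$ (with $0<\alpha(L_\varepsilon)<1$ for small $\varepsilon$) such that either $\varepsilon^{4\omega}\log\alpha(L_\varepsilon)\to0$, or $B_\varepsilon(S_\varepsilon)-x_\varepsilon\ge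 c\,B_\varepsilon(S_\varepsilon)$ for some $c>0$ and all small $\varepsilon$, $$\lim_{\varepsilon\to0}\frac{\log\beta(L_\varepsilon,S_\varepsilon)-\log\beta(L_\varepsilon,S_\varepsilon+S_{1\varepsilon})}{\log\beta(L_\varepsilon,S_\varepsilon)}=0 .$$ -/

import Mathlib

open Filter Topology MeasureTheory ProbabilityTheory Asymptotics

namespace SignalDetection

/-- The real Hilbert space `L₂(0,1)` of signals. -/
abbrev Signal : Type := Lp ℝ 2 (volume.restrict (Set.Ioo (0 : ℝ) 1))

/-- Fourier coefficients `θ_j = ∫₀¹ S φ_j dt`. All sequences in this file start at index `0`: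
index `i` stands for `j = i + 1`. -/
noncomputable def fourierCoef (φ : ℕ → Signal) (S : Signal) (i : ℕ) : ℝ :=
  inner ℝ (φ i) S

/-- Law of the observed coefficients `y_j = θ_j + ε ξ_j`, `ξ_j` i.i.d. standard normal, of the
signal `S` in Gaussian white noise of intensity `ε`, i.e. `y_j = ∫ φ_j dY` for
`dY(t) = S(t) dt + ε dw(t)`. -/
noncomputable def observationLaw (φ : ℕ → Signal) (ε : ℝ) (S : Signal) : Measure (ℕ → ℝ) :=
  Measure.infinitePi fun i => gaussianReal (fourierCoef φ S i) (Real.toNNReal (ε ^ 2))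

/-- `ρ_ε² = ∑_j ϰ_{εj}²`. -/
noncomputable def rhoSq (κ : ℝ → ℕ → ℝ) (ε : ℝ) : ℝ := ∑' i, κ ε i ^ 2

/-- `A_ε = ε⁻⁴ ∑_j ϰ_{εj}⁴`. -/
noncomputable def ACoef (κ : ℝ → ℕ → ℝ) (ε : ℝ) : ℝ := (ε ^ 4)⁻¹ * ∑' i, κ ε i ^ 4

/-- `k_ε = sup {k : ∑_{j < k} ϰ_{εj}² ≤ ρ_ε² / 2}` (`k` ranges over the positive integers; the
indices `1 ≤ j < k` are `0 ≤ i < k - 1`). -/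
noncomputable def kIndex (κ : ℝ → ℕ → ℝ) (ε : ℝ) : ℕ :=
  sSup {k : ℕ | 1 ≤ k ∧ ∑ i ∈ Finset.range (k - 1), κ ε i ^ 2 ≤ rhoSq κ ε / 2}

/-- The coefficient `ϰ_{ε,n}²` with the index `n ≥ 1` counted from one. -/
def kSqAt (κ : ℝ → ℕ → ℝ) (ε : ℝ) (n : ℕ) : ℝ := κ ε (n - 1) ^ 2

/-- `ϰ_ε² = ϰ_{ε,k_ε}²`. -/
noncomputable def kSq (κ : ℝ → ℕ → ℝ) (ε : ℝ) : ℝ := kSqAt κ ε (kIndex κ ε)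

/-- The conditions A1, A2, A3, A4 on the coefficients `ϰ_{εj}²` (and `ρ_ε² < ∞`). -/
structure WeightConditions (κ : ℝ → ℕ → ℝ) : Prop where
  summable : ∀ ε > 0, Summable fun i => κ ε i ^ 2
  A1 : ∀ ε > 0, Antitone fun i => κ ε i ^ 2
  A2 : ∃ C₁ > 0, ∃ C₂, ∀ ε > 0, C₁ < ACoef κ ε ∧ ACoef κ ε < C₂
  A3 : ∃ C₁ > 0, ∃ lam > (1 : ℝ), ∀ δ > (0 : ℝ), ∀ ε > 0,
    kSqAt κ ε ⌊(1 + δ) * kIndex κ ε⌋₊ < C₁ * (1 + δ) ^ (-lam) * kSq κ ε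
  A4_first : (fun ε => kSqAt κ ε 1) =Θ[𝓝[>] 0] (kSq κ)
  A4_tail : ∀ c > (1 : ℝ), ∃ C > 0, ∀ ε > 0, C * kSq κ ε ≤ kSqAt κ ε ⌊c * kIndex κ ε⌋₊

/-- The test statistic `T_ε = ε⁻² ∑_j ϰ_{εj}² y_j² - ρ_ε²`. -/
noncomputable def testStat (κ : ℝ → ℕ → ℝ) (ε : ℝ) (y : ℕ → ℝ) : ℝ :=
  (ε ^ 2)⁻¹ * ∑' i, κ ε i ^ 2 * y i ^ 2 - rhoSq κ ε

/-- Rejection region of the test `L_ε` with threshold `x`. Under the hypothesis, `ε⁻² T_ε` has mean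
`0` and variance `2 A_ε`, so that `x` is on the standard normal scale. -/
def rejectionRegion (κ : ℝ → ℕ → ℝ) (ε x : ℝ) : Set (ℕ → ℝ) :=
  {y | x < (ε ^ 2)⁻¹ * testStat κ ε y / √(2 * ACoef κ ε)}

/-- Type I error probability `α(L_ε)` of the test with threshold `x`. -/
noncomputable def typeI (φ : ℕ → Signal) (κ : ℝ → ℕ → ℝ) (ε x : ℝ) : ℝ :=
  (observationLaw φ ε 0).real (rejectionRegion κ ε x)

/-- Type II error probability `β(L_ε, S)` of the test with threshold `x`. -/
noncomputable def typeII (φ : ℕ → Signal) (κ : ℝ → ℕ → ℝ) (ε x : ℝ) (S : Signal) : ℝ :=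
  (observationLaw φ ε S).real (rejectionRegion κ ε x)ᶜ

/-- `D_ε(S) = ε⁻⁴ ∑_j ϰ_{εj}² θ_j²`. -/
noncomputable def DCoef (φ : ℕ → Signal) (κ : ℝ → ℕ → ℝ) (ε : ℝ) (S : Signal) : ℝ :=
  (ε ^ 4)⁻¹ * ∑' i, κ ε i ^ 2 * fourierCoef φ S i ^ 2

/-- `B_ε(S) = D_ε(S) / (2 A_ε)^{1/2}`. -/
noncomputable def BCoef (φ : ℕ → Signal) (κ : ℝ → ℕ → ℝ) (ε : ℝ) (S : Signal) : ℝ :=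
  DCoef φ κ ε S / √(2 * ACoef κ ε)

/-- The tests `L_ε` with thresholds `x ε` have type I error probabilities `α(L_ε) ∈ (0,1)`
as `ε` runs along `l`. -/
def IsTestFamily (φ : ℕ → Signal) (κ : ℝ → ℕ → ℝ) (l : Filter ℝ) (x : ℝ → ℝ) : Prop :=
  ∀ᶠ ε in l, 0 < typeI φ κ ε (x ε) ∧ typeI φ κ ε (x ε) < 1

/-- `r_ε⁻² log α(L_ε) → 0` as `ε` runs along `l`. -/
def LogLevelNegligible (φ : ℕ → Signal) (κ : ℝ → ℕ → ℝ) (l : Filter ℝ) (rate x : ℝ → ℝ) : Prop :=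
  Tendsto (fun ε => (rate ε ^ 2)⁻¹ * Real.log (typeI φ κ ε (x ε))) l (𝓝 0)

/-- `r_ε`-LD consistency of the alternatives `S_ε` as `ε` runs along `l`: for all tests `L_ε` based
on `T_ε` with `r_ε⁻² log α(L_ε) → 0` one has `|log β(L_ε, S_ε)| = Ω(r_ε²)`. -/
def LDConsistentAlong (φ : ℕ → Signal) (κ : ℝ → ℕ → ℝ) (l : Filter ℝ) (rate : ℝ → ℝ)
    (S : ℝ → Signal) : Prop :=
  ∀ x : ℝ → ℝ, IsTestFamily φ κ l x → LogLevelNegligible φ κ l rate x →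
    ∃ c > 0, ∀ᶠ ε in l, c * rate ε ^ 2 ≤ |Real.log (typeII φ κ ε (x ε) (S ε))|

/-- `r_ε`-LD consistency of the family `S_ε`, as `ε → 0`, `ε > 0`. -/
def LDConsistent (φ : ℕ → Signal) (κ : ℝ → ℕ → ℝ) (rate : ℝ → ℝ) (S : ℝ → Signal) : Prop :=
  LDConsistentAlong φ κ (𝓝[>] 0) rate S

/-- `r_ε`-LD inconsistency of the family `S_ε`, as `ε → 0`: along no sequence `ε_n → 0`, `ε_n > 0`,
are the alternatives `S_{ε_n}` consistent. -/
def LDInconsistent (φ : ℕ → Signal) (κ : ℝ → ℕ → ℝ) (rate : ℝ → ℝ) (S : ℝ → Signal) : Prop :=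
  ∀ u : ℕ → ℝ, Tendsto u atTop (𝓝[>] 0) → ¬ LDConsistentAlong φ κ (map u atTop) rate S

end SignalDetection

namespace SignalDetection

/-! ### Taylor bounds for the logarithm. -/

section ElementaryInequalities

/-! The rescaled statistic `ε⁻² T_ε` is a centred weighted sum of squares of independent Gaussians,
with mean `D_ε(S)` under `S`. Put `2 A_ε τ = D_ε(S) - x_ε √(2 A_ε)`. As the largest weight
`topWeight` tends to zero fast enough, the statistic has Gaussian large deviations, `-log β ≈ A_ε
τ²`. The upper bound for `β` (`quadForm_lower_tail_le`) is a Chernoff bound valid for every `τ ≥ 0`;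
the lower bound (`le_quadForm_lower_tail`) needs `τ` large with `τ * topWeight` small.

These estimates turn the hypotheses into statements on `D_ε`. A consistent family has `D_ε(S_ε) ≥ c
ε^{-2ω}`, seen by testing with the threshold `-ε^{-ω}` (`le_DCoef_of_consistent`). An inconsistent
one has `D_ε(S_{1ε}) = o(ε^{-2ω})`: were `D_ε` of full order along a sequence, every test of
negligible log-level would have a small enough `β` there, and the family would be consistent along
it (`DCoef_le_of_inconsistent`). Since `D_ε` is a quadratic form and `D_ε(S_ε) = O(ε^{-2ω})`, adding
`S_{1ε}` changes it by `o(ε^{-2ω})`. Either assumption on the test makes `A_ε τ` at least of order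
`ε^{-2ω}`, so `τ` changes only by a factor `1 + o(1)`.

If `τ ≤ ε^{-p}`, the two-sided bounds conclude. Very negative thresholds make `τ` too large for the
lower bound; then `-log β` dominates `ε⁻² ‖S_{1ε}‖²`, and Hölder's inequality for the likelihood
ratio (`typeII_shift_le`) compares the two error probabilities directly. A common exponent `p`
exists precisely because `1 - 2r < 2 - 4r - 2ω`. The comparison is
`eventually_abs_log_typeII_sub_le`. -/

theorem log_one_add_ge {x : ℝ} (hx : 0 ≤ x) : x - x ^ 2 / 2 ≤ Real.log (1 + x) := by
  refine le_trans ?_ (Real.le_log_one_add_of_nonneg hx)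
  rw [le_div_iff₀ (by linarith)]
  nlinarith [pow_nonneg hx 3]

theorem log_one_add_le {x : ℝ} (hx : 0 ≤ x) :
    Real.log (1 + x) ≤ x - x ^ 2 / 2 + x ^ 3 / 3 := by
  have hmono : MonotoneOn (fun y : ℝ => y - y ^ 2 / 2 + y ^ 3 / 3 - Real.log (1 + y))
      (Set.Ici 0) := by
    have hd : ∀ y : ℝ, 0 ≤ y → HasDerivAt
        (fun y : ℝ => y - y ^ 2 / 2 + y ^ 3 / 3 - Real.log (1 + y))
        (1 - y + y ^ 2 - (1 + y)⁻¹) y := by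
      intro y hy
      have h1 : HasDerivAt (fun y : ℝ => Real.log (1 + y)) ((1 + y)⁻¹) y := by
        have := ((hasDerivAt_id y).const_add 1).log (by simp; positivity)
        simpa using this
      have h2 := (((hasDerivAt_id y).sub ((hasDerivAt_pow 2 y).div_const 2)).add
        ((hasDerivAt_pow 3 y).div_const 3)).sub h1
      refine h2.congr_deriv ?_
      norm_num
    refine monotoneOn_of_deriv_nonneg (convex_Ici 0)
      (fun y hy => (hd y hy).continuousAt.continuousWithinAt)
      (fun y hy => ?_) (fun y hy => ?_)
    · rw [interior_Ici] at hy
      exact (hd y (le_of_lt hy)).differentiableAt.differentiableWithinAt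
    · rw [interior_Ici] at hy
      have hy0 : 0 < y := hy
      rw [(hd y hy0.le).deriv, sub_nonneg, inv_le_comm₀ (by positivity) (by nlinarith)]
      rw [inv_le_iff_one_le_mul₀ (by nlinarith)]
      nlinarith [pow_pos hy0 3]
  have := hmono (Set.mem_Ici.2 le_rfl) (Set.mem_Ici.2 hx) hx
  simp at this
  linarith

theorem neg_log_one_sub_le {x : ℝ} (hx : 0 ≤ x) (hx' : x ≤ 1 / 2) :
    -Real.log (1 - x) ≤ x + 2 * x ^ 2 := by
  have h1 : (0 : ℝ) < 1 - x := by linarith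
  have h2 := Real.one_sub_inv_le_log_of_pos h1
  have h3 : (1 - x)⁻¹ ≤ 1 + x + 2 * x ^ 2 := by
    rw [inv_le_iff_one_le_mul₀ h1]
    nlinarith [sq_nonneg x, mul_nonneg hx (mul_nonneg hx (sub_nonneg.2 hx'))]
  linarith

end ElementaryInequalities

/-! ### Laplace transform of the square of one Gaussian variable. -/

section SingleGaussian

variable {m : ℝ} {v : NNReal}

/-- Completing the square: with `d = 1 + 2qv`, tilting by `exp(-q y²)` keeps the density Gaussian
and divides both mean and variance by `d`. Negative `q` is allowed, which the upper tail under the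
null signal needs. -/
theorem gaussianPDFReal_mul_exp_sq (hv : v ≠ 0) {q : ℝ} (hq : 0 < 1 + 2 * q * v) (y : ℝ) :
    gaussianPDFReal m v y * Real.exp (-q * y ^ 2) =
      ((√(1 + 2 * q * v))⁻¹ * Real.exp (-q * m ^ 2 / (1 + 2 * q * v))) *
        gaussianPDFReal (m / (1 + 2 * q * v)) (v / Real.toNNReal (1 + 2 * q * v)) y := by
  have hv' : (0 : ℝ) < v := by positivity
  obtain ⟨d, hd⟩ : ∃ d, d = 1 + 2 * q * v := ⟨_, rfl⟩
  have hqd : q = (d - 1) / (2 * v) := by rw [hd]; field_simp; ring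
  rw [← hd] at hq ⊢
  subst hqd
  simp only [gaussianPDFReal, NNReal.coe_div, Real.coe_toNNReal _ hq.le]
  have h1 : √(2 * Real.pi * (v / d)) = √(2 * Real.pi * v) / √d := by
    rw [← Real.sqrt_div' _ hq.le]; congr 1; ring
  have h2 : √d ≠ 0 := (Real.sqrt_pos.2 hq).ne'
  have h3 : -(y - m) ^ 2 / (2 * v) + -((d - 1) / (2 * v)) * y ^ 2 =
      -((d - 1) / (2 * v)) * m ^ 2 / d + -(y - m / d) ^ 2 / (2 * (v / d)) := by
    field_simp
    ring
  rw [h1, inv_div, mul_assoc, ← Real.exp_add, h3, Real.exp_add]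
  field_simp

theorem mgf_sq_gaussianReal (hv : v ≠ 0) {q : ℝ} (hq : 0 < 1 + 2 * q * v) :
    ∫ y, Real.exp (-q * y ^ 2) ∂(gaussianReal m v) =
      (√(1 + 2 * q * v))⁻¹ * Real.exp (-q * m ^ 2 / (1 + 2 * q * v)) := by
  rw [integral_gaussianReal_eq_integral_smul hv]
  simp_rw [smul_eq_mul, gaussianPDFReal_mul_exp_sq hv hq]
  rw [integral_const_mul, integral_gaussianPDFReal_eq_one, mul_one]
  have : 0 < Real.toNNReal (1 + 2 * q * v) := Real.toNNReal_pos.2 hq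
  positivity

theorem log_mgf_sq_le (hv : v ≠ 0) {q b : ℝ} (hq : 0 ≤ q) (hb : q * v ≤ b) :
    (√(1 + 2 * q * v))⁻¹ * Real.exp (-q * m ^ 2 / (1 + 2 * q * v)) ≤
      Real.exp (-(q * v) + (q * v) ^ 2 - q * m ^ 2 * (1 - 2 * b)) := by
  have hqv : 0 ≤ q * v := by positivity
  have h0 : 0 < 1 + 2 * q * v := by nlinarith
  rw [← Real.exp_log (inv_pos.2 (Real.sqrt_pos.2 h0)), ← Real.exp_add, Real.exp_le_exp,
    Real.log_inv, Real.log_sqrt h0.le]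
  have h1 := log_one_add_ge (x := 2 * q * v) (by nlinarith)
  have h2 : q * m ^ 2 * (1 - 2 * b) ≤ q * m ^ 2 / (1 + 2 * q * v) := by
    rw [le_div_iff₀ h0, mul_assoc]
    refine mul_le_of_le_one_right (by positivity) ?_
    nlinarith
  have h3 : -q * m ^ 2 / (1 + 2 * q * v) = -(q * m ^ 2 / (1 + 2 * q * v)) := by ring
  rw [h3]
  nlinarith

/-- The cubic Taylor term is absorbed as a relative error `4b/3` on the quadratic term, so this
matches `log_mgf_sq_le` to second order when `b` is small. -/
theorem log_mgf_sq_ge (hv : v ≠ 0) {q b : ℝ} (hq : 0 ≤ q) (hb : q * v ≤ b) :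
    Real.exp (-(q * v) + (q * v) ^ 2 * (1 - 4 / 3 * b) - q * m ^ 2) ≤
    (√(1 + 2 * q * v))⁻¹ * Real.exp (-q * m ^ 2 / (1 + 2 * q * v)) := by
  have hqv : 0 ≤ q * v := by positivity
  have h0 : 0 < 1 + 2 * q * v := by nlinarith
  rw [← Real.exp_log (inv_pos.2 (Real.sqrt_pos.2 h0)), ← Real.exp_add, Real.exp_le_exp,
    Real.log_inv, Real.log_sqrt h0.le]
  have h1 := log_one_add_le (x := 2 * q * v) (by nlinarith)
  have h2 : q * m ^ 2 / (1 + 2 * q * v) ≤ q * m ^ 2 := by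
    refine div_le_self (by positivity) (by linarith)
  have h3 : -q * m ^ 2 / (1 + 2 * q * v) = -(q * m ^ 2 / (1 + 2 * q * v)) := by ring
  rw [h3]
  have h4 : (q * v) ^ 2 * (q * v) ≤ (q * v) ^ 2 * b := mul_le_mul_of_nonneg_left hb (sq_nonneg _)
  nlinarith

theorem log_mgf_sq_centered_le (hv : v ≠ 0) {q : ℝ} (hq : 0 ≤ q) (hb : q * v ≤ 1 / 4) :
    (√(1 + 2 * (-q) * v))⁻¹ ≤ Real.exp (q * v + 4 * (q * v) ^ 2) := by
  have hqv : 0 ≤ q * v := by positivity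
  have h0 : 0 < 1 + 2 * (-q) * v := by nlinarith
  rw [← Real.exp_log (inv_pos.2 (Real.sqrt_pos.2 h0)), Real.exp_le_exp,
    Real.log_inv, Real.log_sqrt h0.le]
  have h1 := neg_log_one_sub_le (x := 2 * q * v) (by nlinarith) (by nlinarith)
  have h2 : 1 + 2 * (-q) * v = 1 - 2 * q * v := by ring
  rw [h2]
  nlinarith

end SingleGaussian


/-! ### Change of measure between Gaussian vectors with different means. -/

section GaussianShift

variable {v : NNReal}

/-- The log-likelihood ratio of `N(m', v)` with respect to `N(m, v)`. -/
noncomputable def gaussianLogRatio (v : NNReal) (m m' y : ℝ) : ℝ :=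
  (m' - m) / v * y - (m' ^ 2 - m ^ 2) / (2 * v)

theorem measurable_gaussianLogRatio (m m' : ℝ) : Measurable (gaussianLogRatio v m m') := by
  unfold gaussianLogRatio; fun_prop

theorem gaussianReal_eq_withDensity (hv : v ≠ 0) (m m' : ℝ) :
    gaussianReal m' v = (gaussianReal m v).withDensity
      fun y => ENNReal.ofReal (Real.exp (gaussianLogRatio v m m' y)) := by
  have hv' : (0 : ℝ) < v := by positivity
  have hmeas := measurable_gaussianLogRatio (v := v) m m'
  rw [gaussianReal_of_var_ne_zero m hv, gaussianReal_of_var_ne_zero m' hv,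
    ← withDensity_mul _ (measurable_gaussianPDF m v) (by fun_prop)]
  congr 1
  ext y
  rw [Pi.mul_apply, gaussianPDF, gaussianPDF, ← ENNReal.ofReal_mul (gaussianPDFReal_nonneg _ _ _),
    gaussianPDFReal, gaussianPDFReal, mul_assoc (√(2 * Real.pi * v))⁻¹, ← Real.exp_add,
    gaussianLogRatio]
  congr 3
  field_simp
  ring

theorem lintegral_gaussianLogRatio (hv : v ≠ 0) (m m' q : ℝ) :
    ∫⁻ y, ENNReal.ofReal (Real.exp (q * gaussianLogRatio v m m' y)) ∂(gaussianReal m v) =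
      ENNReal.ofReal (Real.exp (q * (q - 1) * ((m' - m) ^ 2 / (2 * v)))) := by
  have hv' : (0 : ℝ) < v := by positivity
  have h1 : ∀ y, Real.exp (q * gaussianLogRatio v m m' y) =
      Real.exp (-(q * ((m' ^ 2 - m ^ 2) / (2 * v)))) *
        Real.exp (q * (m' - m) / v * y) := by
    intro y
    rw [← Real.exp_add, gaussianLogRatio]
    congr 1
    ring
  simp_rw [h1]
  rw [← ofReal_integral_eq_lintegral_ofReal]
  · rw [integral_const_mul]
    have := congrFun (mgf_id_gaussianReal (μ := m) (v := v)) (q * (m' - m) / v)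
    simp only [mgf, id] at this
    rw [this, ← Real.exp_add]
    congr 2
    field_simp
    ring
  · exact (integrable_exp_mul_gaussianReal _).const_mul _
  · exact ae_of_all _ fun y => by positivity

variable {ι : Type*} [Fintype ι]

theorem pi_gaussianReal_eq_withDensity (hv : v ≠ 0) (m m' : ι → ℝ) :
    Measure.pi (fun i => gaussianReal (m' i) v) =
      (Measure.pi fun i => gaussianReal (m i) v).withDensity
        fun y => ∏ i, ENNReal.ofReal (Real.exp (gaussianLogRatio v (m i) (m' i) (y i))) := by
  symm
  have hmeas : ∀ i, Measurable fun y =>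
      ENNReal.ofReal (Real.exp (gaussianLogRatio v (m i) (m' i) y)) := fun i => by
    have := measurable_gaussianLogRatio (v := v) (m i) (m' i)
    fun_prop
  -- It suffices to check boxes, where the indicator and the density both factor over the
  -- coordinates.
  refine (Measure.pi_eq fun s hs => ?_).symm
  rw [withDensity_apply _ (MeasurableSet.univ_pi hs),
    ← lintegral_indicator (MeasurableSet.univ_pi hs)]
  have h1 : ∀ y : ι → ℝ, (Set.univ.pi s).indicator (fun y => ∏ i,
      ENNReal.ofReal (Real.exp (gaussianLogRatio v (m i) (m' i) (y i)))) y =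
      ∏ i, (s i).indicator
        (fun z => ENNReal.ofReal (Real.exp (gaussianLogRatio v (m i) (m' i) z))) (y i) := by
    intro y
    by_cases hy : y ∈ Set.univ.pi s
    · rw [Set.indicator_of_mem hy]
      exact Finset.prod_congr rfl fun i _ => by
        rw [Set.indicator_of_mem (hy i (Set.mem_univ i))]
    · rw [Set.indicator_of_notMem hy]
      simp only [Set.mem_univ_pi, not_forall] at hy
      obtain ⟨i, hi⟩ := hy
      exact (Finset.prod_eq_zero (Finset.mem_univ i) (Set.indicator_of_notMem hi _)).symm
  simp_rw [h1]
  have hind := iIndepFun_pi (μ := fun i => gaussianReal (m i) v)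
    (X := fun i => (s i).indicator
      (fun z => ENNReal.ofReal (Real.exp (gaussianLogRatio v (m i) (m' i) z))))
    fun i => ((hmeas i).indicator (hs i)).aemeasurable
  rw [lintegral_prod_eq_prod_lintegral_of_indepFun _ _ hind
    fun i => ((hmeas i).indicator (hs i)).comp (measurable_pi_apply i)]
  refine Finset.prod_congr rfl fun i _ => ?_
  have h2 := (measurePreserving_eval (fun i => gaussianReal (m i) v) i).lintegral_comp
    ((hmeas i).indicator (hs i))
  simp only [Function.eval] at h2
  rw [h2, lintegral_indicator (hs i), gaussianReal_eq_withDensity hv (m i) (m' i),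
    withDensity_apply _ (hs i)]

/-- Shifting the mean of a Gaussian vector changes probabilities by at most a factor and a
power. -/
theorem pi_gaussianReal_shift_le (hv : v ≠ 0) (m m' : ι → ℝ) {δ : ℝ} (hδ : 0 < δ)
    {E : Set (ι → ℝ)} (hE : MeasurableSet E) :
    Measure.pi (fun i => gaussianReal (m' i) v) E ≤
      ENNReal.ofReal (Real.exp ((∑ i, (m' i - m i) ^ 2) / (2 * v * δ))) *
        (Measure.pi (fun i => gaussianReal (m i) v) E) ^ (1 / (1 + δ)) := by
  have hv' : (0 : ℝ) < v := by positivity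
  set μ := Measure.pi fun i => gaussianReal (m i) v with hμ
  have hmeas : ∀ i, Measurable fun y =>
      ENNReal.ofReal (Real.exp (gaussianLogRatio v (m i) (m' i) y)) := fun i => by
    have := measurable_gaussianLogRatio (v := v) (m i) (m' i)
    fun_prop
  have hmeasP : Measurable fun y : ι → ℝ =>
      ∏ i, ENNReal.ofReal (Real.exp (gaussianLogRatio v (m i) (m' i) (y i))) :=
    Finset.measurable_fun_prod _ fun i _ => (hmeas i).comp (measurable_pi_apply i)
  -- Hölder with exponent `1 + δ` on the indicator of `E` and `q = (1+δ)/δ` on the likelihood ratio.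
  -- The `q`-norm of the latter is `exp((q-1)|m'-m|²/(2v))`, and `q - 1 = 1/δ`.
  have hpq : (1 + δ).HolderConjugate ((1 + δ) / δ) := by
    rw [Real.holderConjugate_iff]
    refine ⟨by linarith, ?_⟩
    field_simp
  rw [pi_gaussianReal_eq_withDensity hv m m', withDensity_apply _ hE, ← lintegral_indicator hE]
  have h1 : ∀ y : ι → ℝ, E.indicator (fun y => ∏ i,
      ENNReal.ofReal (Real.exp (gaussianLogRatio v (m i) (m' i) (y i)))) y =
      (((E.indicator fun _ => (1 : ENNReal)) : (ι → ℝ) → ENNReal) * fun y : ι → ℝ =>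
        ∏ i, ENNReal.ofReal (Real.exp (gaussianLogRatio v (m i) (m' i) (y i)))) y := by
    intro y
    by_cases hy : y ∈ E <;> simp [hy]
  simp_rw [h1]
  refine (ENNReal.lintegral_mul_le_Lp_mul_Lq μ hpq
    (measurable_const.indicator hE).aemeasurable hmeasP.aemeasurable).trans ?_
  rw [mul_comm]
  refine mul_le_mul' ?_ ?_
  · have h2 : ∀ y : ι → ℝ,
        (∏ i, ENNReal.ofReal (Real.exp (gaussianLogRatio v (m i) (m' i) (y i)))) ^
          ((1 + δ) / δ) =
        ∏ i, ENNReal.ofReal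
          (Real.exp ((1 + δ) / δ * gaussianLogRatio v (m i) (m' i) (y i))) := by
      intro y
      rw [← ENNReal.prod_rpow_of_nonneg hpq.symm.nonneg]
      refine Finset.prod_congr rfl fun i _ => ?_
      rw [ENNReal.ofReal_rpow_of_pos (Real.exp_pos _), ← Real.exp_mul, mul_comm]
    have hmeasq : ∀ i, Measurable fun y => ENNReal.ofReal
        (Real.exp ((1 + δ) / δ * gaussianLogRatio v (m i) (m' i) y)) := fun i => by
      have := measurable_gaussianLogRatio (v := v) (m i) (m' i)
      fun_prop
    simp_rw [h2]
    have hind := iIndepFun_pi (μ := fun i => gaussianReal (m i) v)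
      (X := fun i z => ENNReal.ofReal
        (Real.exp ((1 + δ) / δ * gaussianLogRatio v (m i) (m' i) z)))
      fun i => (hmeasq i).aemeasurable
    have h3 : ∀ i, ∫⁻ y, ENNReal.ofReal
        (Real.exp ((1 + δ) / δ * gaussianLogRatio v (m i) (m' i) (y i))) ∂μ =
        ENNReal.ofReal (Real.exp ((1 + δ) / δ * ((1 + δ) / δ - 1) *
          ((m' i - m i) ^ 2 / (2 * v)))) := by
      intro i
      have h4 := (measurePreserving_eval (fun i => gaussianReal (m i) v) i).lintegral_comp
        (hmeasq i)
      refine Eq.trans ?_ (h4.trans (lintegral_gaussianLogRatio hv _ _ _))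
      rfl
    have h6 : ∫⁻ y, ∏ i, ENNReal.ofReal
        (Real.exp ((1 + δ) / δ * gaussianLogRatio v (m i) (m' i) (y i))) ∂μ = _ :=
      (lintegral_prod_eq_prod_lintegral_of_indepFun Finset.univ _ hind
        fun i => (hmeasq i).comp (measurable_pi_apply i)).trans
        (Finset.prod_congr rfl fun i _ => h3 i)
    rw [h6, ← ENNReal.ofReal_prod_of_nonneg fun i _ => (Real.exp_pos _).le, ← Real.exp_sum,
      ENNReal.ofReal_rpow_of_pos (Real.exp_pos _), ← Real.exp_mul, ← Finset.mul_sum,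
      ← Finset.sum_div]
    refine le_of_eq ?_
    congr 2
    field_simp
    ring
  · refine ENNReal.rpow_le_rpow ?_ (by positivity)
    have h5 : ∀ y : ι → ℝ, (E.indicator (fun _ => (1 : ENNReal)) y) ^ (1 + δ) =
        E.indicator (fun _ => 1) y := by
      intro y
      by_cases hy : y ∈ E
      · simp [hy]
      · simp [hy, show 0 < 1 + δ by linarith]
    rw [lintegral_congr h5, lintegral_indicator hE]
    simp

end GaussianShift


/-- Law of a sequence of independent Gaussian variables with means `m i` and variance `v`. -/
noncomputable abbrev gaussianSeq (m : ℕ → ℝ) (v : NNReal) : Measure (ℕ → ℝ) :=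
  Measure.infinitePi fun i => gaussianReal (m i) v

/-- The weighted sum of squares `∑ i, w i * y i ^ 2`. -/
noncomputable def quadForm (w y : ℕ → ℝ) : ℝ := ∑' i, w i * y i ^ 2

/-- The weighted sum of the first `n` squares. -/
def quadPartial (w : ℕ → ℝ) (n : ℕ) (y : ℕ → ℝ) : ℝ := ∑ i ∈ Finset.range n, w i * y i ^ 2

/-! ### Infinite weighted sums of squares: exponential moments and the upper tail. -/

section QuadForm

variable {w m : ℕ → ℝ} {v : NNReal}

theorem measurable_quadPartial (w : ℕ → ℝ) (n : ℕ) : Measurable (quadPartial w n) := by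
  unfold quadPartial; fun_prop

theorem measurable_quadForm (w : ℕ → ℝ) : Measurable (quadForm w) := by
  unfold quadForm
  exact Measurable.tsum fun i => by fun_prop

theorem quadPartial_mono (hw : ∀ i, 0 ≤ w i) (y : ℕ → ℝ) : Monotone fun n => quadPartial w n y :=
  fun _ _ hab => Finset.sum_le_sum_of_subset_of_nonneg (Finset.range_mono hab)
    fun i _ _ => mul_nonneg (hw i) (sq_nonneg _)

theorem quadForm_nonneg (hw : ∀ i, 0 ≤ w i) (y : ℕ → ℝ) : 0 ≤ quadForm w y :=
  tsum_nonneg fun i => mul_nonneg (hw i) (sq_nonneg _)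

theorem lintegral_sq_gaussianReal (a : ℝ) (v : NNReal) :
    ∫⁻ y, ENNReal.ofReal (y ^ 2) ∂(gaussianReal a v) = ENNReal.ofReal (v + a ^ 2) := by
  have hL : MemLp id 2 (gaussianReal a v) := memLp_id_gaussianReal' 2 (by simp)
  have h1 := variance_eq_sub hL
  rw [variance_id_gaussianReal] at h1
  simp only [Pi.pow_apply, id] at h1
  rw [integral_id_gaussianReal] at h1
  have h2 := ofReal_integral_eq_lintegral_ofReal hL.integrable_sq
    (ae_of_all _ fun y => sq_nonneg _)
  simp only [id] at h2
  rw [← h2]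
  congr 1
  linarith

/-- The expected sum `∑ w_i (v + m_i²)` is finite. This matters because `quadForm` takes the default
value `0` at a divergent series, so its relation to partial sums holds only almost everywhere. -/
theorem ae_summable_quadForm (hw : ∀ i, 0 ≤ w i) (hws : Summable w)
    (hwm : Summable fun i => w i * m i ^ 2) :
    ∀ᵐ y ∂(gaussianSeq m v), Summable fun i => w i * y i ^ 2 := by
  have h1 : ∀ i, ∫⁻ y, ENNReal.ofReal (w i * y i ^ 2) ∂(gaussianSeq m v) =
      ENNReal.ofReal (w i * (v + m i ^ 2)) := by
    intro i
    have h2 := (measurePreserving_eval_infinitePi (fun i => gaussianReal (m i) v) i).lintegral_comp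
      (f := fun y => ENNReal.ofReal (w i * y ^ 2)) (by fun_prop)
    simp only [Function.eval] at h2
    rw [h2]
    simp_rw [ENNReal.ofReal_mul (hw i)]
    rw [lintegral_const_mul _ (by fun_prop), lintegral_sq_gaussianReal]
  have h3 : ∫⁻ y, ∑' i, ENNReal.ofReal (w i * y i ^ 2) ∂(gaussianSeq m v) ≠ ⊤ := by
    rw [lintegral_tsum fun i => Measurable.aemeasurable (by fun_prop)]
    simp_rw [h1]
    have h4 : Summable fun i => w i * (v + m i ^ 2) := by
      simp_rw [mul_add]
      exact (hws.mul_right _).add hwm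
    exact h4.tsum_ofReal_ne_top
  filter_upwards [ae_lt_top' (Measurable.tsum fun i => by fun_prop).aemeasurable h3]
    with y hy
  exact (ENNReal.summable_toReal hy.ne).congr fun i =>
    ENNReal.toReal_ofReal (mul_nonneg (hw i) (sq_nonneg _))

theorem tendsto_quadPartial {y : ℕ → ℝ} (hy : Summable fun i => w i * y i ^ 2) :
    Tendsto (fun n => quadPartial w n y) atTop (𝓝 (quadForm w y)) :=
  hy.hasSum.tendsto_sum_nat

theorem quadPartial_le_quadForm (hw : ∀ i, 0 ≤ w i) {y : ℕ → ℝ}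
    (hy : Summable fun i => w i * y i ^ 2) (n : ℕ) : quadPartial w n y ≤ quadForm w y :=
  hy.sum_le_tsum _ fun i _ => mul_nonneg (hw i) (sq_nonneg _)

theorem mgf_quadPartial (hv : v ≠ 0) {t : ℝ} (n : ℕ) (ht : ∀ i, 0 < 1 + 2 * (t * w i) * v) :
    ∫ y, Real.exp (-t * quadPartial w n y) ∂(gaussianSeq m v) =
      ∏ i ∈ Finset.range n, ((√(1 + 2 * (t * w i) * v))⁻¹ *
        Real.exp (-(t * w i) * m i ^ 2 / (1 + 2 * (t * w i) * v))) := by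
  have hind := iIndepFun_infinitePi (P := fun i => gaussianReal (m i) v)
    (X := fun i y => w i * y ^ 2) fun i => by fun_prop
  have h1 := hind.mgf_sum (t := -t) (fun i => by fun_prop) (Finset.range n)
  have h2 : mgf (∑ i ∈ Finset.range n, fun y : ℕ → ℝ => w i * y i ^ 2) (gaussianSeq m v) (-t) =
      ∫ y, Real.exp (-t * quadPartial w n y) ∂(gaussianSeq m v) := by
    simp only [mgf, quadPartial, Finset.sum_apply]
  rw [← h2, h1]
  refine Finset.prod_congr rfl fun i _ => ?_
  have h3 := (measurePreserving_eval_infinitePi (fun i => gaussianReal (m i) v) i).map_eq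
  rw [← mgf_sq_gaussianReal hv (ht i)]
  simp only [mgf]
  rw [← h3, integral_map (measurable_pi_apply i).aemeasurable
    (Continuous.aestronglyMeasurable (by fun_prop))]
  refine integral_congr_ae (ae_of_all _ fun y => ?_)
  simp only
  ring_nf

theorem integrable_exp_quadForm (hw : ∀ i, 0 ≤ w i) {t : ℝ} (ht : 0 ≤ t) :
    Integrable (fun y => Real.exp (-t * quadForm w y)) (gaussianSeq m v) := by
  refine Integrable.mono' (integrable_const 1) ?_ (ae_of_all _ fun y => ?_)
  · have := measurable_quadForm w
    exact Measurable.aestronglyMeasurable (by fun_prop)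
  · rw [Real.norm_eq_abs, abs_of_pos (Real.exp_pos _), Real.exp_le_one_iff]
    nlinarith [quadForm_nonneg hw y]

theorem tendsto_mgf_quadPartial (hw : ∀ i, 0 ≤ w i) (hws : Summable w)
    (hwm : Summable fun i => w i * m i ^ 2) {t : ℝ} (ht : 0 ≤ t) :
    Tendsto (fun n => ∫ y, Real.exp (-t * quadPartial w n y) ∂(gaussianSeq m v)) atTop
      (𝓝 (∫ y, Real.exp (-t * quadForm w y) ∂(gaussianSeq m v))) := by
  refine tendsto_integral_of_dominated_convergence (fun _ => 1) (fun n => ?_)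
    (integrable_const 1) (fun n => ae_of_all _ fun y => ?_) ?_
  · have := measurable_quadPartial w n
    exact Measurable.aestronglyMeasurable (by fun_prop)
  · rw [Real.norm_eq_abs, abs_of_pos (Real.exp_pos _), Real.exp_le_one_iff]
    have : 0 ≤ quadPartial w n y := Finset.sum_nonneg fun i _ => mul_nonneg (hw i) (sq_nonneg _)
    nlinarith
  · filter_upwards [ae_summable_quadForm hw hws hwm] with y hy
    exact (Real.continuous_exp.tendsto _).comp ((tendsto_quadPartial hy).const_mul _)

theorem mgf_quadForm_le (hv : v ≠ 0) (hw : ∀ i, 0 ≤ w i) (hws : Summable w)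
    (hws2 : Summable fun i => w i ^ 2) (hwm : Summable fun i => w i * m i ^ 2) {b : ℝ}
    (hb : ∀ i, w i * v ≤ b) {t : ℝ} (ht : 0 ≤ t) :
    ∫ y, Real.exp (-t * quadForm w y) ∂(gaussianSeq m v) ≤
      Real.exp (-t * (v * ∑' i, w i) + t ^ 2 * (v ^ 2 * ∑' i, w i ^ 2)
        - t * (1 - 2 * (t * b)) * ∑' i, w i * m i ^ 2) := by
  have hsum := (((hws.hasSum.mul_left (v : ℝ)).mul_left (-t)).add
    ((hws2.hasSum.mul_left ((v : ℝ) ^ 2)).mul_left (t ^ 2))).sub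
    (hwm.hasSum.mul_left (t * (1 - 2 * (t * b))))
  refine le_of_tendsto_of_tendsto' (tendsto_mgf_quadPartial hw hws hwm ht)
    ((Real.continuous_exp.tendsto _).comp hsum.tendsto_sum_nat) fun n => ?_
  have hq : ∀ i, 0 ≤ t * w i := fun i => mul_nonneg ht (hw i)
  rw [mgf_quadPartial hv n fun i => by have := hq i; positivity]
  simp only [Function.comp_apply]
  rw [Real.exp_sum]
  refine Finset.prod_le_prod (fun i _ => by positivity) fun i _ => ?_
  refine (log_mgf_sq_le hv (hq i) (b := t * b) ?_).trans (le_of_eq ?_)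
  · rw [mul_assoc]; exact mul_le_mul_of_nonneg_left (hb i) ht
  · congr 1; ring

theorem le_mgf_quadForm (hv : v ≠ 0) (hw : ∀ i, 0 ≤ w i) (hws : Summable w)
    (hws2 : Summable fun i => w i ^ 2) (hwm : Summable fun i => w i * m i ^ 2) {b : ℝ}
    (hb : ∀ i, w i * v ≤ b) {t : ℝ} (ht : 0 ≤ t) :
    Real.exp (-t * (v * ∑' i, w i) + t ^ 2 * (1 - 4 / 3 * (t * b)) * (v ^ 2 * ∑' i, w i ^ 2)
        - t * ∑' i, w i * m i ^ 2) ≤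
      ∫ y, Real.exp (-t * quadForm w y) ∂(gaussianSeq m v) := by
  have hsum := (((hws.hasSum.mul_left (v : ℝ)).mul_left (-t)).add
    ((hws2.hasSum.mul_left ((v : ℝ) ^ 2)).mul_left (t ^ 2 * (1 - 4 / 3 * (t * b))))).sub
    (hwm.hasSum.mul_left t)
  refine le_of_tendsto_of_tendsto' ((Real.continuous_exp.tendsto _).comp hsum.tendsto_sum_nat)
    (tendsto_mgf_quadPartial hw hws hwm ht) fun n => ?_
  have hq : ∀ i, 0 ≤ t * w i := fun i => mul_nonneg ht (hw i)
  rw [mgf_quadPartial hv n fun i => by have := hq i; positivity]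
  simp only [Function.comp_apply]
  rw [Real.exp_sum]
  refine Finset.prod_le_prod (fun i _ => by positivity) fun i _ => ?_
  refine (le_of_eq ?_).trans (log_mgf_sq_ge hv (hq i) (b := t * b) ?_)
  · congr 1; ring
  · rw [mul_assoc]; exact mul_le_mul_of_nonneg_left (hb i) ht

/-- Chernoff bound for the upper tail of a centred weighted chi-square variable. -/
theorem quadForm_upper_tail (hv : v ≠ 0) (hw : ∀ i, 0 ≤ w i) (hws : Summable w)
    (hws2 : Summable fun i => w i ^ 2) {b : ℝ}
    (hb : ∀ i, w i * v ≤ b) (hA : 0 < v ^ 2 * ∑' i, w i ^ 2) {z : ℝ} (hz : 0 ≤ z)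
    (hzb : z * b ≤ 2 * (v ^ 2 * ∑' i, w i ^ 2)) :
    (gaussianSeq 0 v).real {y | z + v * ∑' i, w i < quadForm w y} ≤
      Real.exp (-(z ^ 2 / (16 * (v ^ 2 * ∑' i, w i ^ 2)))) := by
  set A : ℝ := v ^ 2 * ∑' i, w i ^ 2 with hAdef
  set R : ℝ := v * ∑' i, w i with hR
  -- The minimiser of the Chernoff exponent `-t z + 4 t² A`; `hzb` is exactly what makes `t b ≤
  -- 1/4`.
  set t : ℝ := z / (8 * A) with ht
  have ht0 : 0 ≤ t := by positivity
  have htb : ∀ i, t * w i * v ≤ 1 / 4 := by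
    intro i
    have h1 : t * (w i * v) ≤ t * b := mul_le_mul_of_nonneg_left (hb i) ht0
    have h2 : t * b ≤ 1 / 4 := by
      rw [ht, div_mul_eq_mul_div, div_le_iff₀ (by positivity)]
      linarith
    nlinarith
  have hq : ∀ i, 0 ≤ t * w i := fun i => mul_nonneg ht0 (hw i)
  -- Working with partial sums avoids integrability of the growing exponential of the infinite sum;
  -- the full mean `R` in the threshold keeps the bound uniform in `n`.
  have hn : ∀ n, (gaussianSeq 0 v).real {y | z + R < quadPartial w n y} ≤
      Real.exp (-(z ^ 2 / (16 * A))) := by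
    intro n
    have h0 : ∀ i, 0 < 1 + 2 * (-t * w i) * v := fun i => by nlinarith [htb i]
    have hmgf := mgf_quadPartial (m := 0) hv n h0
    rw [neg_neg] at hmgf
    have hpos : (0 : ℝ) < ∫ y, Real.exp (t * quadPartial w n y) ∂(gaussianSeq 0 v) := by
      rw [hmgf]
      refine Finset.prod_pos fun i _ => mul_pos (inv_pos.2 (Real.sqrt_pos.2 (h0 i))) (Real.exp_pos _)
    have hint : Integrable (fun y => Real.exp (t * quadPartial w n y)) (gaussianSeq 0 v) :=
      Integrable.of_integral_ne_zero hpos.ne'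
    have h1 := measure_ge_le_exp_mul_mgf (z + R) ht0 hint
    have hsub : {y | z + R < quadPartial w n y} ⊆ {y | z + R ≤ quadPartial w n y} :=
      Set.ofPred_subset_ofPred.2 fun y hy => hy.le
    refine (measureReal_mono hsub).trans (h1.trans ?_)
    rw [mgf, hmgf]
    have h2 : ∏ i ∈ Finset.range n, ((√(1 + 2 * (-t * w i) * v))⁻¹ *
        Real.exp (-(-t * w i) * (0 : ℕ → ℝ) i ^ 2 / (1 + 2 * (-t * w i) * v))) ≤
        Real.exp (t * R + 4 * t ^ 2 * A) := by
      have h3 : ∏ i ∈ Finset.range n, ((√(1 + 2 * (-t * w i) * v))⁻¹ *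
          Real.exp (-(-t * w i) * (0 : ℕ → ℝ) i ^ 2 / (1 + 2 * (-t * w i) * v))) ≤
          ∏ i ∈ Finset.range n, Real.exp (t * w i * v + 4 * (t * w i * v) ^ 2) := by
        refine Finset.prod_le_prod (fun i _ => by positivity) fun i _ => ?_
        have := log_mgf_sq_centered_le hv (hq i) (htb i)
        simpa [neg_mul] using this
      refine h3.trans ?_
      rw [← Real.exp_sum, Real.exp_le_exp]
      have hs : HasSum (fun i => t * w i * v + 4 * (t * w i * v) ^ 2)
          (t * R + 4 * t ^ 2 * A) := by
        have := ((hws.hasSum.mul_left (v : ℝ)).mul_left t).add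
          ((hws2.hasSum.mul_left ((v : ℝ) ^ 2)).mul_left (4 * t ^ 2))
        exact this.congr_fun (fun i => by ring)
      exact sum_le_hasSum _ (fun i _ => by have := hq i; positivity) hs
    refine (mul_le_mul_of_nonneg_left h2 (Real.exp_pos _).le).trans (le_of_eq ?_)
    rw [← Real.exp_add]
    congr 1
    rw [ht]
    field_simp
    ring
  have hmono : Monotone fun n => {y : ℕ → ℝ | z + R < quadPartial w n y} :=
    fun a c hac y hy => lt_of_lt_of_le hy (quadPartial_mono hw y hac)
  have hlim := tendsto_measure_iUnion_atTop (μ := gaussianSeq 0 v) hmono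
  have hsub : (gaussianSeq 0 v) {y | z + R < quadForm w y} ≤
      (gaussianSeq 0 v) (⋃ n, {y | z + R < quadPartial w n y}) := by
    refine measure_mono_ae ?_
    filter_upwards [ae_summable_quadForm (m := 0) (v := v) hw hws (by simp)] with y hy hlt
    have := (tendsto_quadPartial hy).eventually (lt_mem_nhds hlt)
    obtain ⟨n, hn⟩ := this.exists
    exact Set.mem_iUnion.2 ⟨n, hn⟩
  have hle : (gaussianSeq 0 v) (⋃ n, {y | z + R < quadPartial w n y}) ≤
      ENNReal.ofReal (Real.exp (-(z ^ 2 / (16 * A)))) :=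
    le_of_tendsto' hlim fun n => by
      have := hn n
      rw [measureReal_def] at this
      exact (ENNReal.le_ofReal_iff_toReal_le (measure_ne_top _ _) (Real.exp_pos _).le).2 this
  exact ENNReal.toReal_le_of_le_ofReal (Real.exp_pos _).le (hsub.trans hle)

end QuadForm


/-- Lower bound for a lower tail probability in terms of the Laplace transform. -/
theorem le_lower_tail_of_laplace {Ω : Type*} [MeasurableSpace Ω] {μ : Measure Ω}
    [IsProbabilityMeasure μ] {X : Ω → ℝ} (hX : Measurable X) {t u c d : ℝ} (ht : 0 ≤ t)
    (hu : 0 ≤ u)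
    (h₀ : Integrable (fun ω => Real.exp (-t * X ω)) μ)
    (h₁ : Integrable (fun ω => Real.exp (-(t - u) * X ω)) μ)
    (h₂ : Integrable (fun ω => Real.exp (-(t + u) * X ω)) μ) :
    Real.exp (t * (c - d)) * (∫ ω, Real.exp (-t * X ω) ∂μ
      - Real.exp (-u * c) * ∫ ω, Real.exp (-(t - u) * X ω) ∂μ
      - Real.exp (u * (c - d)) * ∫ ω, Real.exp (-(t + u) * X ω) ∂μ) ≤
      μ.real {ω | X ω ≤ c} := by
  have hE : MeasurableSet {ω | X ω ≤ c} := measurableSet_le hX measurable_const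
  have hint : Integrable (fun ω => Real.exp (t * (c - d)) * (Real.exp (-t * X ω)
      - Real.exp (-u * c) * Real.exp (-(t - u) * X ω)
      - Real.exp (u * (c - d)) * Real.exp (-(t + u) * X ω))) μ :=
    ((h₀.sub (h₁.const_mul _)).sub (h₂.const_mul _)).const_mul _
  have hint2 : Integrable ({ω | X ω ≤ c}.indicator fun _ => (1 : ℝ)) μ :=
    (integrable_const 1).indicator hE
  -- Integrates the pointwise bound `e^{t(c-d)} e^{-tX} (1 - e^{u(X-c)} - e^{u(c-d-X)}) ≤ 1_{X ≤
  -- c}`. Outside the window `[c-d, c]` one subtracted exponential is at least `1`; inside, the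
  -- prefactor is at most `1`. It replaces a tilted law concentrated on the window.
  have key := integral_mono hint hint2 fun ω => ?_
  · have e0 : ∫ ω, (Real.exp (-t * X ω) - Real.exp (-u * c) * Real.exp (-(t - u) * X ω)
        - Real.exp (u * (c - d)) * Real.exp (-(t + u) * X ω)) ∂μ =
        ∫ ω, (Real.exp (-t * X ω) - Real.exp (-u * c) * Real.exp (-(t - u) * X ω)) ∂μ
        - ∫ ω, Real.exp (u * (c - d)) * Real.exp (-(t + u) * X ω) ∂μ :=
      integral_sub (h₀.sub (h₁.const_mul _)) (h₂.const_mul _)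
    rw [integral_const_mul, e0, integral_sub h₀ (h₁.const_mul _), integral_const_mul,
      integral_const_mul] at key
    refine key.trans (le_of_eq ?_)
    rw [integral_indicator hE]
    simp
  · simp only
    have e1 : Real.exp (-u * c) * Real.exp (-(t - u) * X ω) =
        Real.exp (-t * X ω) * Real.exp (u * (X ω - c)) := by
      rw [← Real.exp_add, ← Real.exp_add]; congr 1; ring
    have e2 : Real.exp (u * (c - d)) * Real.exp (-(t + u) * X ω) =
        Real.exp (-t * X ω) * Real.exp (u * (c - d - X ω)) := by
      rw [← Real.exp_add, ← Real.exp_add]; congr 1; ring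
    rw [e1, e2]
    have p0 := Real.exp_pos (t * (c - d))
    have p1 := Real.exp_pos (-t * X ω)
    have p2 := Real.exp_pos (u * (X ω - c))
    have p3 := Real.exp_pos (u * (c - d - X ω))
    have hnn : 0 ≤ {ω | X ω ≤ c}.indicator (fun _ => (1 : ℝ)) ω :=
      Set.indicator_nonneg (fun _ _ => zero_le_one) _
    by_cases hc : X ω ≤ c
    · by_cases hd : c - d ≤ X ω
      · rw [Set.indicator_of_mem (by exact hc)]
        have e3 : Real.exp (t * (c - d)) * Real.exp (-t * X ω) ≤ 1 := by
          rw [← Real.exp_add, Real.exp_le_one_iff]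
          nlinarith
        have := mul_pos p0 (mul_pos p1 p2)
        have := mul_pos p0 (mul_pos p1 p3)
        nlinarith
      · have h1 : 1 ≤ Real.exp (u * (c - d - X ω)) :=
          Real.one_le_exp (mul_nonneg hu (by linarith))
        refine le_trans (mul_nonpos_of_nonneg_of_nonpos p0.le ?_) hnn
        nlinarith [mul_pos p1 p2]
    · have h1 : 1 ≤ Real.exp (u * (X ω - c)) := Real.one_le_exp (mul_nonneg hu (by linarith))
      refine le_trans (mul_nonpos_of_nonneg_of_nonpos p0.le ?_) hnn
      nlinarith [mul_pos p1 p3]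

/-! ### Lower tails of weighted sums of squares, and their dependence on the means. -/

section QuadFormTails

variable {w m : ℕ → ℝ} {v : NNReal} {b A D R : ℝ}

theorem quadForm_lower_tail_le (hv : v ≠ 0) (hw : ∀ i, 0 ≤ w i) (hws : Summable w)
    (hws2 : Summable fun i => w i ^ 2) (hwm : Summable fun i => w i * m i ^ 2)
    (hb : ∀ i, w i * v ≤ b) (hR : R = v * ∑' i, w i) (hA : A = v ^ 2 * ∑' i, w i ^ 2)
    (hD : D = ∑' i, w i * m i ^ 2) {z τ : ℝ} (hτ : 0 ≤ τ) (hz : D - z = 2 * A * τ) :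
    (gaussianSeq m v).real {y | quadForm w y ≤ z + R} ≤
      Real.exp (-(τ ^ 2 * (A - 2 * (b * D)))) := by
  refine (measure_le_le_exp_mul_mgf (z + R) (neg_nonpos.2 hτ)
    (integrable_exp_quadForm hw hτ)).trans ?_
  refine (mul_le_mul_of_nonneg_left (mgf_quadForm_le hv hw hws hws2 hwm hb hτ)
    (Real.exp_pos _).le).trans (le_of_eq ?_)
  rw [← hR, ← hA, ← hD, ← Real.exp_add]
  congr 1
  obtain rfl : z = D - 2 * A * τ := by linarith
  ring

theorem le_quadForm_lower_tail (hv : v ≠ 0) (hw : ∀ i, 0 ≤ w i) (hws : Summable w)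
    (hws2 : Summable fun i => w i ^ 2) (hwm : Summable fun i => w i * m i ^ 2)
    (hb : ∀ i, w i * v ≤ b) (hR : R = v * ∑' i, w i) (hA : A = v ^ 2 * ∑' i, w i ^ 2)
    (hD : D = ∑' i, w i * m i ^ 2) {z τ δ : ℝ} (hτ : 0 ≤ τ) (hz : D - z = 2 * A * τ)
    (hδ : 0 < δ) (hδ' : δ ≤ 1 / 2) (h1 : 8 * (b * D) + 9 / 2 * (τ * (b * A)) ≤ δ ^ 2 * A / 2)
    (h2 : 4 ≤ δ ^ 2 * (τ ^ 2 * A)) :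
    Real.exp (-(τ ^ 2 * A * (1 + 2 * δ) ^ 2)) ≤
      (gaussianSeq m v).real {y | quadForm w y ≤ z + R} := by
  have hb0 : 0 ≤ b := le_trans (by have := hw 0; positivity) (hb 0)
  have hA0 : 0 ≤ A := hA ▸ mul_nonneg (by positivity) (tsum_nonneg fun i => sq_nonneg _)
  have hD0 : 0 ≤ D := hD ▸ tsum_nonneg fun i => mul_nonneg (hw i) (sq_nonneg _)
  have hbD : 0 ≤ b * D := mul_nonneg hb0 hD0
  have hbA : 0 ≤ τ * (b * A) := by positivity
  have hτ2 : 0 ≤ τ ^ 2 := sq_nonneg _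
  have hlog2 : Real.log 2 ≤ 1 := by have := Real.log_two_lt_d9; linarith
  -- To leading order the tilt `t` moves the mean to `z + R - 2δAτ`, the midpoint of the window of
  -- width `d = 4δAτ` below `z + R`. With `u = δτ`, leaving the window on either side costs a factor
  -- `exp(-δ²τ²A)`. By `h1` the errors use at most half of this exponent, and `h2` leaves at least
  -- `2 ≥ 2 log 2`, hence the factors `1/4` in `b1` and `b2`.
  set t : ℝ := (1 + δ) * τ with ht
  set u : ℝ := δ * τ with hu
  have ht0 : 0 ≤ t := by positivity
  have hu0 : 0 ≤ u := by positivity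
  have htu : t - u = τ := by rw [ht, hu]; ring
  have hz' : z = D - 2 * A * τ := by linarith
  have key := le_lower_tail_of_laplace (μ := gaussianSeq m v) (measurable_quadForm w)
    (c := z + R) (d := 4 * δ * (A * τ)) ht0 hu0
    (integrable_exp_quadForm hw ht0) (integrable_exp_quadForm hw (by rw [htu]; exact hτ))
    (integrable_exp_quadForm hw (add_nonneg ht0 hu0))
  refine le_trans ?_ key
  have hM0 := le_mgf_quadForm hv hw hws hws2 hwm hb ht0
  have hM1 := mgf_quadForm_le hv hw hws hws2 hwm hb (t := t - u) (by rw [htu]; exact hτ)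
  have hM2 := mgf_quadForm_le hv hw hws hws2 hwm hb (add_nonneg ht0 hu0)
  rw [← hR, ← hA, ← hD] at hM0 hM1 hM2
  set M0 := ∫ y, Real.exp (-t * quadForm w y) ∂(gaussianSeq m v)
  set M1 := ∫ y, Real.exp (-(t - u) * quadForm w y) ∂(gaussianSeq m v)
  set M2 := ∫ y, Real.exp (-(t + u) * quadForm w y) ∂(gaussianSeq m v)
  set e : ℝ := -t * R + t ^ 2 * (1 - 4 / 3 * (t * b)) * A - t * D with he
  have hcube : (1 + δ) ^ 3 ≤ 27 / 8 := by
    have : (1 + δ) ^ 3 ≤ (3 / 2 : ℝ) ^ 3 := pow_le_pow_left₀ (by linarith) (by linarith) 3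
    norm_num at this ⊢; exact this
  have hsq : (1 + 2 * δ) ^ 2 ≤ 4 := by nlinarith
  have herr : 4 / 3 * t ^ 3 * b * A ≤ τ ^ 2 * (9 / 2 * (τ * (b * A))) := by
    have h3 : 4 / 3 * t ^ 3 * b * A = 4 / 3 * (1 + δ) ^ 3 * (τ ^ 2 * (τ * (b * A))) := by
      rw [ht]; ring
    rw [h3]
    have := mul_le_mul_of_nonneg_right hcube (mul_nonneg hτ2 hbA)
    linarith
  have hmain : τ ^ 2 * (8 * (b * D)) + τ ^ 2 * (9 / 2 * (τ * (b * A))) ≤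
      δ ^ 2 * (τ ^ 2 * A) / 2 := by
    have := mul_le_mul_of_nonneg_left h1 hτ2
    linarith
  have hlog4 : Real.exp (-(2 * Real.log 2)) = 1 / 4 := by
    rw [Real.exp_neg, mul_comm, Real.exp_mul, Real.exp_log two_pos]; norm_num
  have hD8 : 2 * (1 + 2 * δ) ^ 2 * (τ ^ 2 * (b * D)) ≤ τ ^ 2 * (8 * (b * D)) := by
    have := mul_le_mul_of_nonneg_right hsq (mul_nonneg hτ2 hbD)
    linarith
  have b1 : Real.exp (-u * (z + R)) * M1 ≤ 1 / 4 * Real.exp e := by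
    refine (mul_le_mul_of_nonneg_left hM1 (Real.exp_pos _).le).trans ?_
    rw [← hlog4, ← Real.exp_add, ← Real.exp_add, Real.exp_le_exp, htu, he, hz']
    have : -u * (D - 2 * A * τ + R) +
        (-τ * R + τ ^ 2 * A - τ * (1 - 2 * (τ * b)) * D) =
        -t * R - t * D + t ^ 2 * A - δ ^ 2 * (τ ^ 2 * A) + τ ^ 2 * (2 * (b * D)) := by
      rw [hu, ht]; ring
    rw [this]
    have := mul_nonneg hτ2 hbD
    linarith
  have b2 : Real.exp (u * (z + R - 4 * δ * (A * τ))) * M2 ≤ 1 / 4 * Real.exp e := by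
    refine (mul_le_mul_of_nonneg_left hM2 (Real.exp_pos _).le).trans ?_
    rw [← hlog4, ← Real.exp_add, ← Real.exp_add, Real.exp_le_exp, he, hz']
    have : u * (D - 2 * A * τ + R - 4 * δ * (A * τ)) +
        (-(t + u) * R + (t + u) ^ 2 * A - (t + u) * (1 - 2 * ((t + u) * b)) * D) =
        -t * R - t * D + t ^ 2 * A - δ ^ 2 * (τ ^ 2 * A)
          + 2 * (1 + 2 * δ) ^ 2 * (τ ^ 2 * (b * D)) := by
      rw [hu, ht]; ring
    rw [this]
    linarith
  have hlow : 1 / 2 * Real.exp e ≤ M0 - Real.exp (-u * (z + R)) * M1 -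
      Real.exp (u * (z + R - 4 * δ * (A * τ))) * M2 := by linarith
  refine le_trans ?_ (mul_le_mul_of_nonneg_left hlow (Real.exp_pos _).le)
  have hhalf : Real.exp (-Real.log 2) = 1 / 2 := by
    rw [Real.exp_neg, Real.exp_log two_pos]; norm_num
  rw [← hhalf, ← Real.exp_add, ← Real.exp_add, Real.exp_le_exp, he, hz']
  have : t * (D - 2 * A * τ + R - 4 * δ * (A * τ)) + (-Real.log 2 +
      (-t * R + t ^ 2 * (1 - 4 / 3 * (t * b)) * A - t * D)) =
      -Real.log 2 - 4 / 3 * t ^ 3 * b * A - τ ^ 2 * A * (1 + 2 * δ) ^ 2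
        + δ ^ 2 * (τ ^ 2 * A) := by
    rw [ht]; ring
  rw [this]
  have := mul_nonneg hτ2 hbD
  linarith

theorem ae_eq_iInter_quadPartial (hw : ∀ i, 0 ≤ w i) (hws : Summable w)
    (hwm : Summable fun i => w i * m i ^ 2) (c : ℝ) :
    (gaussianSeq m v) {y | quadForm w y ≤ c} =
      (gaussianSeq m v) (⋂ n, {y | quadPartial w n y ≤ c}) := by
  refine measure_congr ?_
  filter_upwards [ae_summable_quadForm (v := v) hw hws hwm] with y hy
  refine propext ⟨fun h => Set.mem_iInter.2 fun n =>
    (quadPartial_le_quadForm hw hy n).trans h, fun h => ?_⟩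
  exact le_of_tendsto' (tendsto_quadPartial hy) fun n => Set.mem_iInter.1 h n

/-- Comparison of lower tails under two mean sequences. -/
theorem quadForm_lower_tail_shift_le {m' : ℕ → ℝ} (hv : v ≠ 0) (hw : ∀ i, 0 ≤ w i)
    (hws : Summable w) (hwm : Summable fun i => w i * m i ^ 2)
    (hwm' : Summable fun i => w i * m' i ^ 2) {N δ : ℝ}
    (hN : ∀ n, ∑ i ∈ Finset.range n, (m' i - m i) ^ 2 ≤ N) (hδ : 0 < δ) (c : ℝ) :
    (gaussianSeq m' v).real {y | quadForm w y ≤ c} ≤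
      Real.exp (N / (2 * v * δ)) *
        ((gaussianSeq m v).real {y | quadForm w y ≤ c}) ^ (1 / (1 + δ)) := by
  have hv' : (0 : ℝ) < v := by positivity
  have hcyl : ∀ (a : ℕ → ℝ) (n : ℕ), (gaussianSeq a v) {y | quadPartial w n y ≤ c} =
      Measure.pi (fun i : Finset.range n => gaussianReal (a i) v)
        {y | ∑ i : Finset.range n, w i * y i ^ 2 ≤ c} := by
    intro a n
    have h1 : MeasurableSet {y : Finset.range n → ℝ | ∑ i : Finset.range n, w i * y i ^ 2 ≤ c} :=
      measurableSet_le (by fun_prop) measurable_const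
    rw [← Measure.infinitePi_map_restrict (fun i => gaussianReal (a i) v),
      Measure.map_apply (Finset.measurable_restrict _) h1]
    congr 1
    ext y
    simp only [Set.mem_ofPred_eq, Set.preimage_ofPred_eq, quadPartial, Finset.restrict]
    rw [Finset.sum_coe_sort (Finset.range n) fun i => w i * y i ^ 2]
  -- The bound sees the shift only through `N`, so it is uniform in `n` and passes to the decreasing
  -- limit of cylinder events; no infinite-dimensional density is needed.
  have hn : ∀ n, (gaussianSeq m' v) {y | quadPartial w n y ≤ c} ≤
      ENNReal.ofReal (Real.exp (N / (2 * v * δ))) *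
        ((gaussianSeq m v) {y | quadPartial w n y ≤ c}) ^ (1 / (1 + δ)) := by
    intro n
    rw [hcyl, hcyl]
    have h1 : MeasurableSet {y : Finset.range n → ℝ | ∑ i : Finset.range n, w i * y i ^ 2 ≤ c} :=
      measurableSet_le (by fun_prop) measurable_const
    refine (pi_gaussianReal_shift_le hv (fun i : Finset.range n => m i) (fun i => m' i) hδ
      h1).trans ?_
    gcongr
    rw [Finset.sum_coe_sort (Finset.range n) fun i => (m' i - m i) ^ 2]
    exact hN n
  have hlim : ∀ a : ℕ → ℝ, (Summable fun i => w i * a i ^ 2) →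
      Tendsto (fun n => (gaussianSeq a v) {y | quadPartial w n y ≤ c}) atTop
        (𝓝 ((gaussianSeq a v) {y | quadForm w y ≤ c})) := by
    intro a ha
    rw [ae_eq_iInter_quadPartial hw hws ha]
    refine tendsto_measure_iInter_atTop
      (fun n => (measurableSet_le (measurable_quadPartial w n)
        measurable_const).nullMeasurableSet)
      (fun i j hij => Set.ofPred_subset_ofPred.2 fun y hy => (quadPartial_mono hw y hij).trans hy)
      ⟨0, measure_ne_top _ _⟩
  have hfin := le_of_tendsto_of_tendsto' (hlim m' hwm')
    (ENNReal.Tendsto.const_mul ((hlim m hwm).ennrpow_const (1 / (1 + δ)))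
      (Or.inr ENNReal.ofReal_ne_top)) hn
  have := ENNReal.toReal_mono (ENNReal.mul_ne_top ENNReal.ofReal_ne_top
    (ENNReal.rpow_ne_top_of_nonneg (by positivity) (measure_ne_top _ _))) hfin
  rwa [ENNReal.toReal_mul, ENNReal.toReal_ofReal (Real.exp_pos _).le,
    ← ENNReal.toReal_rpow] at this

end QuadFormTails


/-! ### Translation to the test statistic and its error probabilities. -/

/-- The weights `ε⁻⁴ ϰ_{εi}²` of the squared observations in `ε⁻² T_ε`. -/
noncomputable def statWeight (κ : ℝ → ℕ → ℝ) (ε : ℝ) (i : ℕ) : ℝ := κ ε i ^ 2 * (ε ^ 4)⁻¹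

/-- The largest coefficient `ε⁻² ϰ_{ε1}²` of the centred chi-square variables in `ε⁻² T_ε`. -/
noncomputable def topWeight (κ : ℝ → ℕ → ℝ) (ε : ℝ) : ℝ := κ ε 0 ^ 2 * (ε ^ 2)⁻¹

variable {φ : ℕ → Signal} {κ : ℝ → ℕ → ℝ} {ε : ℝ}

theorem coe_toNNReal_sq (ε : ℝ) : ((Real.toNNReal (ε ^ 2) : NNReal) : ℝ) = ε ^ 2 :=
  Real.coe_toNNReal _ (sq_nonneg _)

theorem toNNReal_sq_ne_zero (hε : 0 < ε) : Real.toNNReal (ε ^ 2) ≠ 0 :=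
  (Real.toNNReal_pos.2 (by positivity)).ne'

theorem statWeight_nonneg (κ : ℝ → ℕ → ℝ) (ε : ℝ) (i : ℕ) : 0 ≤ statWeight κ ε i := by
  unfold statWeight; positivity

theorem topWeight_nonneg (κ : ℝ → ℕ → ℝ) (ε : ℝ) : 0 ≤ topWeight κ ε := by
  unfold topWeight; positivity

theorem DCoef_nonneg (φ : ℕ → Signal) (κ : ℝ → ℕ → ℝ) (ε : ℝ) (S : Signal) :
    0 ≤ DCoef φ κ ε S :=
  mul_nonneg (by positivity) (tsum_nonneg fun i => by positivity)

theorem DCoef_eq (φ : ℕ → Signal) (κ : ℝ → ℕ → ℝ) (ε : ℝ) (S : Signal) :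
    DCoef φ κ ε S = ∑' i, statWeight κ ε i * fourierCoef φ S i ^ 2 := by
  rw [DCoef, ← tsum_mul_left]
  exact tsum_congr fun i => by rw [statWeight]; ring

theorem fourierCoef_zero (φ : ℕ → Signal) : fourierCoef φ 0 = 0 := by
  ext i; simp [fourierCoef]

theorem fourierCoef_add (φ : ℕ → Signal) (S S' : Signal) (i : ℕ) :
    fourierCoef φ (S + S') i = fourierCoef φ S i + fourierCoef φ S' i := by
  simp [fourierCoef, inner_add_right]

theorem fourierCoef_sub (φ : ℕ → Signal) (S S' : Signal) (i : ℕ) :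
    fourierCoef φ (S - S') i = fourierCoef φ S i - fourierCoef φ S' i := by
  simp [fourierCoef, inner_sub_right]

theorem summable_fourierCoef_sq (hφ : Orthonormal ℝ φ) (S : Signal) :
    Summable fun i => fourierCoef φ S i ^ 2 := by
  simpa [fourierCoef] using hφ.inner_products_summable S

theorem sum_fourierCoef_sq_le (hφ : Orthonormal ℝ φ) (S : Signal) (n : ℕ) :
    ∑ i ∈ Finset.range n, fourierCoef φ S i ^ 2 ≤ ‖S‖ ^ 2 := by
  simpa [fourierCoef] using hφ.sum_inner_products_le S (s := Finset.range n)

theorem tsum_fourierCoef_sq_le (hφ : Orthonormal ℝ φ) (S : Signal) :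
    ∑' i, fourierCoef φ S i ^ 2 ≤ ‖S‖ ^ 2 :=
  le_of_tendsto' (summable_fourierCoef_sq hφ S).hasSum.tendsto_sum_nat (sum_fourierCoef_sq_le hφ S)

theorem ACoef_eq (κ : ℝ → ℕ → ℝ) (hε : 0 < ε) :
    ACoef κ ε = ((Real.toNNReal (ε ^ 2) : NNReal) : ℝ) ^ 2 * ∑' i, statWeight κ ε i ^ 2 := by
  rw [coe_toNNReal_sq, ACoef, ← tsum_mul_left, ← tsum_mul_left]
  refine tsum_congr fun i => ?_
  rw [statWeight]
  field_simp

namespace WeightConditions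

theorem sq_le (hκ : WeightConditions κ) (hε : 0 < ε) (i : ℕ) : κ ε i ^ 2 ≤ κ ε 0 ^ 2 :=
  hκ.A1 ε hε (Nat.zero_le i)

theorem statWeight_le (hκ : WeightConditions κ) (hε : 0 < ε) (i : ℕ) :
    statWeight κ ε i ≤ topWeight κ ε * (ε ^ 2)⁻¹ := by
  have h : topWeight κ ε * (ε ^ 2)⁻¹ = κ ε 0 ^ 2 * (ε ^ 4)⁻¹ := by
    rw [topWeight, mul_assoc, ← mul_inv, ← pow_add]
  rw [h, statWeight]
  exact mul_le_mul_of_nonneg_right (hκ.sq_le hε i) (by positivity)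

theorem statWeight_mul_le (hκ : WeightConditions κ) (hε : 0 < ε) (i : ℕ) :
    statWeight κ ε i * (Real.toNNReal (ε ^ 2) : NNReal) ≤ topWeight κ ε := by
  rw [coe_toNNReal_sq]
  refine (mul_le_mul_of_nonneg_right (hκ.statWeight_le hε i) (sq_nonneg _)).trans (le_of_eq ?_)
  field_simp

theorem summable_statWeight (hκ : WeightConditions κ) (hε : 0 < ε) :
    Summable (statWeight κ ε) := (hκ.summable ε hε).mul_right _

theorem summable_pow_four (hκ : WeightConditions κ) (hε : 0 < ε) :
    Summable fun i => κ ε i ^ 4 := by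
  refine Summable.of_nonneg_of_le (fun i => by positivity) (fun i => ?_)
    ((hκ.summable ε hε).mul_left (κ ε 0 ^ 2))
  have := mul_le_mul_of_nonneg_right (hκ.sq_le hε i) (sq_nonneg (κ ε i))
  calc κ ε i ^ 4 = κ ε i ^ 2 * κ ε i ^ 2 := by ring
    _ ≤ _ := this

theorem summable_statWeight_sq (hκ : WeightConditions κ) (hε : 0 < ε) :
    Summable fun i => statWeight κ ε i ^ 2 :=
  ((hκ.summable_pow_four hε).mul_right ((ε ^ 8)⁻¹)).congr fun i => by
    rw [statWeight]; field_simp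

theorem summable_statWeight_mul (hκ : WeightConditions κ) (hφ : Orthonormal ℝ φ) (hε : 0 < ε)
    (S : Signal) : Summable fun i => statWeight κ ε i * fourierCoef φ S i ^ 2 :=
  Summable.of_nonneg_of_le (fun _ => mul_nonneg (statWeight_nonneg _ _ _) (sq_nonneg _))
    (fun i => mul_le_mul_of_nonneg_right (hκ.statWeight_le hε i) (sq_nonneg _))
    ((summable_fourierCoef_sq hφ S).mul_left _)

theorem ACoef_pos (hκ : WeightConditions κ) (hε : 0 < ε) : 0 < ACoef κ ε := by
  obtain ⟨C₁, h₁, C₂, h⟩ := hκ.A2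
  exact h₁.trans (h ε hε).1

theorem DCoef_le (hκ : WeightConditions κ) (hφ : Orthonormal ℝ φ) (hε : 0 < ε) (S : Signal) :
    DCoef φ κ ε S ≤ topWeight κ ε * (‖S‖ ^ 2 * (ε ^ 2)⁻¹) := by
  rw [DCoef_eq]
  calc ∑' i, statWeight κ ε i * fourierCoef φ S i ^ 2
      ≤ ∑' i, topWeight κ ε * (ε ^ 2)⁻¹ * fourierCoef φ S i ^ 2 :=
        (hκ.summable_statWeight_mul hφ hε S).tsum_le_tsum
          (fun i => mul_le_mul_of_nonneg_right (hκ.statWeight_le hε i) (sq_nonneg _))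
          ((summable_fourierCoef_sq hφ S).mul_left _)
    _ = topWeight κ ε * (ε ^ 2)⁻¹ * ∑' i, fourierCoef φ S i ^ 2 := tsum_mul_left
    _ ≤ topWeight κ ε * (ε ^ 2)⁻¹ * ‖S‖ ^ 2 :=
        mul_le_mul_of_nonneg_left (tsum_fourierCoef_sq_le hφ S)
          (mul_nonneg (topWeight_nonneg _ _) (by positivity))
    _ = _ := by ring

/-- Young's inequality `2|ac| ≤ η a² + η⁻¹ c²`, applied to each cross term and summed with the
weights. -/
theorem abs_DCoef_add_sub_le (hκ : WeightConditions κ) (hφ : Orthonormal ℝ φ) (hε : 0 < ε)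
    (S S₁ : Signal) {η : ℝ} (hη : 0 < η) :
    |DCoef φ κ ε (S + S₁) - DCoef φ κ ε S| ≤
      η * DCoef φ κ ε S + (1 + η⁻¹) * DCoef φ κ ε S₁ := by
  have hs := (hκ.summable_statWeight_mul hφ hε S).hasSum
  have hs₁ := (hκ.summable_statWeight_mul hφ hε S₁).hasSum
  have hs' := (hκ.summable_statWeight_mul hφ hε (S + S₁)).hasSum
  rw [← DCoef_eq] at hs hs₁ hs'
  have hterm : ∀ i, |fourierCoef φ (S + S₁) i ^ 2 - fourierCoef φ S i ^ 2| ≤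
      η * fourierCoef φ S i ^ 2 + (1 + η⁻¹) * fourierCoef φ S₁ i ^ 2 := by
    intro i
    rw [fourierCoef_add]
    set a := fourierCoef φ S i
    set c := fourierCoef φ S₁ i
    have h1 : 2 * |a * c| ≤ η * a ^ 2 + η⁻¹ * c ^ 2 := by
      have h2 : 0 ≤ η⁻¹ * (η * |a| - |c|) ^ 2 := by positivity
      have h3 : η⁻¹ * (η * |a| - |c|) ^ 2 = η * |a| ^ 2 + η⁻¹ * |c| ^ 2 - 2 * (|a| * |c|) := by
        field_simp; ring
      rw [h3, sq_abs, sq_abs, ← abs_mul] at h2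
      linarith
    have h4 : (a + c) ^ 2 - a ^ 2 = 2 * (a * c) + c ^ 2 := by ring
    rw [h4]
    refine (abs_add_le _ _).trans ?_
    rw [abs_mul, abs_two, abs_of_nonneg (sq_nonneg c)]
    linarith
  rw [abs_le]
  constructor
  · have := hasSum_le ?_ ((hs.mul_left (-η)).sub (hs₁.mul_left (1 + η⁻¹))) (hs'.sub hs)
    · linarith
    · intro i
      have := mul_le_mul_of_nonneg_left (neg_le_of_abs_le (hterm i)) (statWeight_nonneg κ ε i)
      linarith
  · refine hasSum_le (fun i => ?_) (hs'.sub hs) ((hs.mul_left η).add (hs₁.mul_left (1 + η⁻¹)))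
    have := mul_le_mul_of_nonneg_left (le_of_abs_le (hterm i)) (statWeight_nonneg κ ε i)
    linarith

end WeightConditions

/-- The mean `ε⁻² ρ_ε²` of the weighted sum of squares under the hypothesis. -/
noncomputable def statMean (κ : ℝ → ℕ → ℝ) (ε : ℝ) : ℝ :=
  ((Real.toNNReal (ε ^ 2) : NNReal) : ℝ) * ∑' i, statWeight κ ε i

theorem mem_rejectionRegion_iff (hκ : WeightConditions κ) (hε : 0 < ε) (x : ℝ) (y : ℕ → ℝ) :
    y ∈ rejectionRegion κ ε x ↔
      x * √(2 * ACoef κ ε) + statMean κ ε < quadForm (statWeight κ ε) y := by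
  have hA := hκ.ACoef_pos hε
  have hsq : 0 < √(2 * ACoef κ ε) := Real.sqrt_pos.2 (by linarith)
  have h1 : (ε ^ 2)⁻¹ * testStat κ ε y =
      quadForm (statWeight κ ε) y - statMean κ ε := by
    rw [testStat, quadForm, statMean, coe_toNNReal_sq, rhoSq]
    have e1 : ∑' i, statWeight κ ε i * y i ^ 2 = (ε ^ 4)⁻¹ * ∑' i, κ ε i ^ 2 * y i ^ 2 := by
      rw [← tsum_mul_left]; exact tsum_congr fun i => by rw [statWeight]; ring
    have e2 : ∑' i, statWeight κ ε i = (∑' i, κ ε i ^ 2) * (ε ^ 4)⁻¹ := tsum_mul_right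
    rw [e1, e2]
    field_simp
  rw [rejectionRegion, Set.mem_ofPred_eq, h1, lt_div_iff₀ hsq, lt_sub_iff_add_lt]

theorem typeI_eq (hκ : WeightConditions κ) (hε : 0 < ε) (x : ℝ) :
    typeI φ κ ε x = (gaussianSeq 0 (Real.toNNReal (ε ^ 2))).real
      {y | x * √(2 * ACoef κ ε) + statMean κ ε < quadForm (statWeight κ ε) y} := by
  rw [typeI, observationLaw, fourierCoef_zero]
  congr 1
  ext y
  exact mem_rejectionRegion_iff hκ hε x y

theorem typeII_eq (hκ : WeightConditions κ) (hε : 0 < ε) (x : ℝ) (S : Signal) :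
    typeII φ κ ε x S = (gaussianSeq (fourierCoef φ S) (Real.toNNReal (ε ^ 2))).real
      {y | quadForm (statWeight κ ε) y ≤ x * √(2 * ACoef κ ε) + statMean κ ε} := by
  rw [typeII, observationLaw]
  congr 1
  ext y
  rw [Set.mem_compl_iff, mem_rejectionRegion_iff hκ hε x y, not_lt, Set.mem_ofPred_eq]

theorem typeI_eq_one_sub (hκ : WeightConditions κ) (hε : 0 < ε) (x : ℝ) :
    typeI φ κ ε x = 1 - typeII φ κ ε x 0 := by
  have hm : MeasurableSet
      {y | quadForm (statWeight κ ε) y ≤ x * √(2 * ACoef κ ε) + statMean κ ε} :=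
    measurableSet_le (measurable_quadForm _) measurable_const
  rw [typeI_eq hκ hε, typeII_eq hκ hε, fourierCoef_zero, ← probReal_compl_eq_one_sub hm]
  congr 1
  ext y
  simp

theorem typeI_anti (hκ : WeightConditions κ) (hε : 0 < ε) {x x' : ℝ} (h : x ≤ x') :
    typeI φ κ ε x' ≤ typeI φ κ ε x := by
  rw [typeI_eq hκ hε, typeI_eq hκ hε]
  refine measureReal_mono (Set.ofPred_subset_ofPred.2 fun y hy => lt_of_le_of_lt ?_ hy)
  gcongr

/-- The constant `1/8` is not sharp; only the quadratic order in `x` is needed. -/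
theorem typeI_le (hκ : WeightConditions κ) (hε : 0 < ε) {x : ℝ} (hx : 0 ≤ x)
    (hxb : x * √(2 * ACoef κ ε) * topWeight κ ε ≤ 2 * ACoef κ ε) :
    typeI φ κ ε x ≤ Real.exp (-(x ^ 2 / 8)) := by
  have hA := hκ.ACoef_pos hε
  rw [typeI_eq hκ hε]
  have hAeq := ACoef_eq κ hε
  refine (quadForm_upper_tail (toNNReal_sq_ne_zero hε) (statWeight_nonneg κ ε)
    (hκ.summable_statWeight hε) (hκ.summable_statWeight_sq hε) (hκ.statWeight_mul_le hε)
    (by rw [← hAeq]; exact hA) (mul_nonneg hx (Real.sqrt_nonneg _))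
    (by rw [← hAeq]; exact hxb)).trans (le_of_eq ?_)
  rw [← hAeq, mul_pow, Real.sq_sqrt (by linarith)]
  congr 2
  field_simp
  ring

theorem typeII_le (hκ : WeightConditions κ) (hφ : Orthonormal ℝ φ) (hε : 0 < ε) {x τ : ℝ}
    {S : Signal} (hτ : 0 ≤ τ)
    (h : DCoef φ κ ε S - x * √(2 * ACoef κ ε) = 2 * ACoef κ ε * τ) :
    typeII φ κ ε x S ≤
      Real.exp (-(τ ^ 2 * (ACoef κ ε - 2 * (topWeight κ ε * DCoef φ κ ε S)))) := by
  rw [typeII_eq hκ hε]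
  exact quadForm_lower_tail_le (toNNReal_sq_ne_zero hε) (statWeight_nonneg κ ε)
    (hκ.summable_statWeight hε) (hκ.summable_statWeight_sq hε)
    (hκ.summable_statWeight_mul hφ hε S) (hκ.statWeight_mul_le hε) rfl (ACoef_eq κ hε)
    (DCoef_eq φ κ ε S) hτ h

theorem le_typeII (hκ : WeightConditions κ) (hφ : Orthonormal ℝ φ) (hε : 0 < ε) {x τ δ : ℝ}
    {S : Signal} (hτ : 0 ≤ τ)
    (h : DCoef φ κ ε S - x * √(2 * ACoef κ ε) = 2 * ACoef κ ε * τ)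
    (hδ : 0 < δ) (hδ' : δ ≤ 1 / 2)
    (h1 : 8 * (topWeight κ ε * DCoef φ κ ε S) + 9 / 2 * (τ * (topWeight κ ε * ACoef κ ε)) ≤
      δ ^ 2 * ACoef κ ε / 2)
    (h2 : 4 ≤ δ ^ 2 * (τ ^ 2 * ACoef κ ε)) :
    Real.exp (-(τ ^ 2 * ACoef κ ε * (1 + 2 * δ) ^ 2)) ≤ typeII φ κ ε x S := by
  rw [typeII_eq hκ hε]
  exact le_quadForm_lower_tail (toNNReal_sq_ne_zero hε) (statWeight_nonneg κ ε)
    (hκ.summable_statWeight hε) (hκ.summable_statWeight_sq hε)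
    (hκ.summable_statWeight_mul hφ hε S) (hκ.statWeight_mul_le hε) rfl (ACoef_eq κ hε)
    (DCoef_eq φ κ ε S) hτ h hδ hδ' h1 h2

theorem typeII_shift_le (hκ : WeightConditions κ) (hφ : Orthonormal ℝ φ) (hε : 0 < ε)
    (x : ℝ) (S S' : Signal) {δ : ℝ} (hδ : 0 < δ) :
    typeII φ κ ε x S' ≤ Real.exp (‖S' - S‖ ^ 2 / (2 * ε ^ 2 * δ)) *
      typeII φ κ ε x S ^ (1 / (1 + δ)) := by
  rw [typeII_eq hκ hε, typeII_eq hκ hε]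
  have := quadForm_lower_tail_shift_le (m := fourierCoef φ S) (m' := fourierCoef φ S')
    (toNNReal_sq_ne_zero hε) (statWeight_nonneg κ ε)
    (hκ.summable_statWeight hε) (hκ.summable_statWeight_mul hφ hε S)
    (hκ.summable_statWeight_mul hφ hε S') (N := ‖S' - S‖ ^ 2) (fun n => by
      simpa only [fourierCoef_sub] using sum_fourierCoef_sq_le hφ (S' - S) n) hδ
    (x * √(2 * ACoef κ ε) + statMean κ ε)
  rwa [coe_toNNReal_sq] at this

theorem typeII_nonneg (x : ℝ) (S : Signal) : 0 ≤ typeII φ κ ε x S := measureReal_nonneg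

theorem typeII_pos (hκ : WeightConditions κ) (hφ : Orthonormal ℝ φ) (hε : 0 < ε) {x : ℝ}
    (hx : typeI φ κ ε x < 1) (S : Signal) : 0 < typeII φ κ ε x S := by
  have h0 : 0 < typeII φ κ ε x 0 := by
    rw [typeI_eq_one_sub hκ hε] at hx
    linarith
  refine lt_of_le_of_ne (typeII_nonneg x S) fun h => ?_
  -- Absolute continuity: a zero acceptance probability under `S` would force one under the zero
  -- signal.
  have := typeII_shift_le hκ hφ hε x S 0 one_pos
  rw [← h, Real.zero_rpow (by norm_num), mul_zero] at this
  linarith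

theorem neg_log_typeII_shift_le (hκ : WeightConditions κ) (hφ : Orthonormal ℝ φ) (hε : 0 < ε)
    {x : ℝ} (hx : typeI φ κ ε x < 1) (S S' : Signal) {δ : ℝ} (hδ : 0 < δ) :
    -Real.log (typeII φ κ ε x S) ≤ (1 + δ) * (-Real.log (typeII φ κ ε x S') +
      ‖S' - S‖ ^ 2 * (ε ^ 2)⁻¹ / (2 * δ)) := by
  have hS := typeII_pos hκ hφ hε hx S
  have hS' := typeII_pos hκ hφ hε hx S'
  have h := Real.log_le_log hS' (typeII_shift_le hκ hφ hε x S S' hδ)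
  rw [Real.log_mul (Real.exp_pos _).ne' (Real.rpow_pos_of_pos hS _).ne', Real.log_exp,
    Real.log_rpow hS] at h
  have h1 : ‖S' - S‖ ^ 2 / (2 * ε ^ 2 * δ) = ‖S' - S‖ ^ 2 * (ε ^ 2)⁻¹ / (2 * δ) := by
    field_simp
  rw [h1] at h
  have h2 : (1 + δ) * (1 / (1 + δ) * Real.log (typeII φ κ ε x S)) =
      Real.log (typeII φ κ ε x S) := by field_simp
  have := mul_le_mul_of_nonneg_left h (show 0 ≤ 1 + δ by linarith)
  rw [mul_add, h2] at this
  linarith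


/-! ### Comparison of powers of `ε` as `ε` tends to zero from the right. -/

section PowerScale

theorem tendsto_rpow_zero {a : ℝ} (ha : 0 < a) :
    Tendsto (fun ε : ℝ => ε ^ a) (𝓝[>] 0) (𝓝 0) := by
  have := (Real.continuousAt_rpow_const 0 a (Or.inr ha.le)).tendsto
  rw [Real.zero_rpow ha.ne'] at this
  exact this.mono_left nhdsWithin_le_nhds

theorem eventually_rpow_add (a b : ℝ) :
    (fun ε : ℝ => ε ^ a * ε ^ b) =ᶠ[𝓝[>] 0] fun ε => ε ^ (a + b) := by
  filter_upwards [self_mem_nhdsWithin] with ε hε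
  exact (Real.rpow_add hε a b).symm

theorem isBigO_mul_rpow {f g : ℝ → ℝ} {a b c : ℝ} (hf : f =O[𝓝[>] 0] fun ε => ε ^ a)
    (hg : g =O[𝓝[>] 0] fun ε => ε ^ b) (hc : a + b = c) :
    (fun ε => f ε * g ε) =O[𝓝[>] 0] fun ε => ε ^ c :=
  hc ▸ (hf.mul hg).trans_eventuallyEq (eventually_rpow_add a b)

theorem tendsto_zero_of_isBigO_rpow {f : ℝ → ℝ} {a : ℝ} (hf : f =O[𝓝[>] 0] fun ε => ε ^ a)
    (ha : 0 < a) : Tendsto f (𝓝[>] 0) (𝓝 0) :=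
  hf.trans_tendsto (tendsto_rpow_zero ha)

theorem rpow_isLittleO {a b : ℝ} (h : b < a) :
    (fun ε : ℝ => ε ^ a) =o[𝓝[>] 0] fun ε => ε ^ b := by
  refine (isLittleO_iff_tendsto' ?_).2 ((tendsto_rpow_zero (sub_pos.2 h)).congr' ?_)
  · filter_upwards [self_mem_nhdsWithin] with ε hε h0
    exact absurd h0 (Real.rpow_pos_of_pos hε b).ne'
  · filter_upwards [self_mem_nhdsWithin] with ε hε
    exact Real.rpow_sub hε a b

theorem eventually_rpow_le_mul {a b : ℝ} (h : b < a) {c : ℝ} (hc : 0 < c) :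
    ∀ᶠ ε : ℝ in 𝓝[>] 0, ε ^ a ≤ c * ε ^ b := by
  filter_upwards [(rpow_isLittleO h).def hc, self_mem_nhdsWithin] with ε h1 hε
  rwa [Real.norm_of_nonneg (Real.rpow_pos_of_pos hε a).le,
    Real.norm_of_nonneg (Real.rpow_pos_of_pos hε b).le] at h1

theorem eventually_le_rpow_neg {a : ℝ} (ha : a < 0) (T : ℝ) :
    ∀ᶠ ε : ℝ in 𝓝[>] 0, T ≤ ε ^ a := by
  filter_upwards [eventually_rpow_le_mul ha (c := (|T| + 1)⁻¹) (by positivity),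
    self_mem_nhdsWithin] with ε h _
  rw [Real.rpow_zero, inv_mul_eq_div, one_le_div (by positivity)] at h
  linarith [le_abs_self T]

theorem inv_sq_isBigO :
    (fun ε : ℝ => (ε ^ 2)⁻¹) =O[𝓝[>] 0] fun ε : ℝ => ε ^ (-2 : ℝ) := by
  refine EventuallyEq.isBigO ?_
  filter_upwards [self_mem_nhdsWithin] with ε hε
  rw [Real.rpow_neg (le_of_lt hε)]
  congr 1
  exact_mod_cast (Real.rpow_natCast ε 2).symm

end PowerScale

/-! ### Asymptotic size of the weights and uniform error bounds. -/

/-- The scaling regime: `ε⁻² ϰ_{ε1}² = O(ε^{2-4r-2ω})` with `0 < 2 ω < 1 - 2 r`. -/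
structure Regime (φ : ℕ → Signal) (κ : ℝ → ℕ → ℝ) (r ω : ℝ) : Prop where
  orthonormal : Orthonormal ℝ φ
  weights : WeightConditions κ
  omega_pos : 0 < ω
  two_omega_lt : 2 * ω < 1 - 2 * r
  topWeight_isBigO : topWeight κ =O[𝓝[>] 0] fun ε => ε ^ (2 - 4 * r - 2 * ω)

namespace WeightConditions

variable {κ : ℝ → ℕ → ℝ}

/-- By monotonicity each of the first `k_ε` terms of `∑ ϰ⁴` is at least `ϰ_ε⁴`. -/
theorem kIndex_mul_kSq_sq_le (hκ : WeightConditions κ) {ε : ℝ} (hε : 0 < ε) :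
    kIndex κ ε * kSq κ ε ^ 2 ≤ ACoef κ ε * ε ^ 4 := by
  have h1 : ACoef κ ε * ε ^ 4 = ∑' i, κ ε i ^ 4 := by
    rw [ACoef]; field_simp
  rw [h1]
  refine le_trans ?_ ((hκ.summable_pow_four hε).sum_le_tsum (Finset.range (kIndex κ ε))
    fun i _ => by positivity)
  rw [← nsmul_eq_mul]
  refine (le_of_eq ?_).trans (Finset.card_nsmul_le_sum _ _ (kSq κ ε ^ 2) fun i hi => ?_)
  · rw [Finset.card_range]
  · have h2 : kSq κ ε ≤ κ ε i ^ 2 :=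
      hκ.A1 ε hε (Nat.le_sub_one_of_lt (Finset.mem_range.1 hi))
    have h3 : 0 ≤ kSq κ ε := sq_nonneg _
    calc kSq κ ε ^ 2 ≤ (κ ε i ^ 2) ^ 2 := pow_le_pow_left₀ h3 h2 2
      _ = _ := by ring

/-- From `k_ε ϰ_ε⁴ = O(ε⁴)` and the order of `k_ε` one gets `ϰ_ε² = O(ε^{4-4r-2ω})`; A4 transfers
this to the first coefficient, and dividing by `ε²` finishes. -/
theorem topWeight_isBigO (hκ : WeightConditions κ) {r ω : ℝ}
    (hk : (fun ε : ℝ => (kIndex κ ε : ℝ)) =Θ[𝓝[>] 0] fun ε : ℝ => ε ^ (-4 + 8 * r + 4 * ω)) :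
    topWeight κ =O[𝓝[>] 0] fun ε => ε ^ (2 - 4 * r - 2 * ω) := by
  obtain ⟨C₁, h₁, C₂, hA⟩ := hκ.A2
  have h1 : (fun ε => (kIndex κ ε : ℝ) * kSq κ ε ^ 2) =O[𝓝[>] 0] fun ε : ℝ => ε ^ (4 : ℝ) := by
    refine IsBigO.of_bound C₂ ?_
    filter_upwards [self_mem_nhdsWithin] with ε hε
    have hε' : (0 : ℝ) < ε := hε
    rw [Real.norm_of_nonneg (by positivity), Real.norm_of_nonneg (by positivity)]
    have h2 : ε ^ (4 : ℝ) = ε ^ 4 := by exact_mod_cast Real.rpow_natCast ε 4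
    rw [h2]
    exact (hκ.kIndex_mul_kSq_sq_le hε').trans
      (mul_le_mul_of_nonneg_right (hA ε hε').2.le (by positivity))
  have h2 : (fun ε => ε ^ (-4 + 8 * r + 4 * ω) * kSq κ ε ^ 2) =O[𝓝[>] 0]
      fun ε : ℝ => ε ^ (4 : ℝ) :=
    (hk.2.mul (isBigO_refl (fun ε => kSq κ ε ^ 2) _)).trans h1
  have h3 : (fun ε => kSq κ ε ^ 2) =O[𝓝[>] 0]
      fun ε : ℝ => (ε ^ (4 - 4 * r - 2 * ω)) ^ 2 := by
    have h4 := isBigO_mul_rpow (isBigO_refl (fun ε : ℝ => ε ^ (4 - 8 * r - 4 * ω)) (𝓝[>] 0)) h2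
      (c := 8 - 8 * r - 4 * ω) (by ring)
    refine (h4.congr' ?_ ?_)
    · filter_upwards [self_mem_nhdsWithin] with ε hε
      rw [← mul_assoc, ← Real.rpow_add hε]
      ring_nf
      simp
    · filter_upwards [self_mem_nhdsWithin] with ε hε
      rw [sq, ← Real.rpow_add hε]
      ring_nf
  have h4 := h3.of_pow two_ne_zero
  have h5 : (fun ε => κ ε 0 ^ 2) =O[𝓝[>] 0] fun ε : ℝ => ε ^ (4 - 4 * r - 2 * ω) :=
    hκ.A4_first.1.trans h4
  exact isBigO_mul_rpow h5 inv_sq_isBigO (by ring)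

end WeightConditions

namespace Regime

variable {φ : ℕ → Signal} {κ : ℝ → ℕ → ℝ} {r ω : ℝ} {S : ℝ → Signal}

theorem normSq_isBigO (hS : (fun ε => ‖S ε‖) =O[𝓝[>] 0] fun ε : ℝ => ε ^ (2 * r)) :
    (fun ε => ‖S ε‖ ^ 2 * (ε ^ 2)⁻¹) =O[𝓝[>] 0] fun ε : ℝ => ε ^ (4 * r - 2) := by
  have h7 := isBigO_mul_rpow hS hS (c := 4 * r) (by ring)
  simp_rw [← sq] at h7
  exact isBigO_mul_rpow h7 inv_sq_isBigO (by ring)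

theorem DCoef_isBigO (h : Regime φ κ r ω)
    (hS : (fun ε => ‖S ε‖) =O[𝓝[>] 0] fun ε : ℝ => ε ^ (2 * r)) :
    (fun ε => DCoef φ κ ε (S ε)) =O[𝓝[>] 0] fun ε : ℝ => ε ^ (-2 * ω) := by
  refine IsBigO.trans (IsBigO.of_bound' ?_)
    (isBigO_mul_rpow h.topWeight_isBigO (normSq_isBigO hS) (c := -2 * ω) (by ring))
  filter_upwards [self_mem_nhdsWithin] with ε hε
  rw [Real.norm_of_nonneg (DCoef_nonneg _ _ _ _)]
  exact (h.weights.DCoef_le h.orthonormal hε (S ε)).trans (le_abs_self _)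

theorem tendsto_topWeight_mul (h : Regime φ κ r ω) {f : ℝ → ℝ} {p : ℝ}
    (hf : f =O[𝓝[>] 0] fun ε => ε ^ (-p)) (hp : p < 2 - 4 * r - 2 * ω) :
    Tendsto (fun ε => topWeight κ ε * f ε) (𝓝[>] 0) (𝓝 0) :=
  tendsto_zero_of_isBigO_rpow
    (isBigO_mul_rpow h.topWeight_isBigO hf (c := 2 - 4 * r - 2 * ω - p) (by ring)) (by linarith)

theorem tendsto_topWeight_mul_DCoef (h : Regime φ κ r ω)
    (hS : (fun ε => ‖S ε‖) =O[𝓝[>] 0] fun ε : ℝ => ε ^ (2 * r)) :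
    Tendsto (fun ε => topWeight κ ε * DCoef φ κ ε (S ε)) (𝓝[>] 0) (𝓝 0) := by
  refine h.tendsto_topWeight_mul (p := 2 * ω) ?_ (by linarith [h.two_omega_lt])
  simpa [neg_mul] using h.DCoef_isBigO hS

theorem eventually_typeII_le (h : Regime φ κ r ω)
    (hS : (fun ε => ‖S ε‖) =O[𝓝[>] 0] fun ε : ℝ => ε ^ (2 * r)) {δ : ℝ} (hδ : 0 < δ) :
    ∀ᶠ ε in 𝓝[>] 0, ∀ x τ : ℝ, 0 ≤ τ →
      DCoef φ κ ε (S ε) - x * √(2 * ACoef κ ε) = 2 * ACoef κ ε * τ →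
      typeII φ κ ε x (S ε) ≤ Real.exp (-(τ ^ 2 * ACoef κ ε * (1 - δ))) := by
  obtain ⟨C₁, h₁, C₂, hA⟩ := h.weights.A2
  filter_upwards [self_mem_nhdsWithin, (h.tendsto_topWeight_mul_DCoef hS).eventually
    (gt_mem_nhds (show 0 < δ * C₁ / 2 by positivity))] with ε hε hb x τ hτ heq
  refine (typeII_le h.weights h.orthonormal hε hτ heq).trans (Real.exp_le_exp.2 (neg_le_neg ?_))
  rw [mul_assoc]
  refine mul_le_mul_of_nonneg_left ?_ (sq_nonneg _)
  nlinarith [(hA ε hε).1]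

/-- The quantifiers over `x` and `τ` stand inside the eventual statement: one range of small `ε`
serves all thresholds with `T ≤ τ ≤ G ε`, where `G` may grow as long as `topWeight * G` vanishes. -/
theorem eventually_le_typeII (h : Regime φ κ r ω)
    (hS : (fun ε => ‖S ε‖) =O[𝓝[>] 0] fun ε : ℝ => ε ^ (2 * r)) {δ : ℝ} (hδ : 0 < δ)
    (hδ' : δ ≤ 1 / 2) {G : ℝ → ℝ}
    (hG : Tendsto (fun ε => topWeight κ ε * G ε) (𝓝[>] 0) (𝓝 0)) :
    ∃ T > 0, ∀ᶠ ε in 𝓝[>] 0, ∀ x τ : ℝ, T ≤ τ → τ ≤ G ε →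
      DCoef φ κ ε (S ε) - x * √(2 * ACoef κ ε) = 2 * ACoef κ ε * τ →
      Real.exp (-(τ ^ 2 * ACoef κ ε * (1 + 2 * δ) ^ 2)) ≤ typeII φ κ ε x (S ε) := by
  obtain ⟨C₁, h₁, C₂, hA⟩ := h.weights.A2
  -- The summand `1` gives `τ² ≥ τ`, so `δ² τ² A ≥ 4`. The tolerances `δ²C₁/32` and `δ²/18` below
  -- make each of the two error terms at most `δ²A/4`.
  refine ⟨4 / (δ ^ 2 * C₁) + 1, by positivity, ?_⟩
  filter_upwards [self_mem_nhdsWithin, (h.tendsto_topWeight_mul_DCoef hS).eventually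
    (gt_mem_nhds (show 0 < δ ^ 2 * C₁ / 32 by positivity)),
    hG.eventually (gt_mem_nhds (show 0 < δ ^ 2 / 18 by positivity))]
    with ε hε hb hb' x τ hT hτG heq
  have hC : 0 ≤ 4 / (δ ^ 2 * C₁) := by positivity
  have hτ1 : 1 ≤ τ := by linarith
  have hA1 := (hA ε hε).1
  have hA0 : 0 < ACoef κ ε := h₁.trans hA1
  refine le_typeII h.weights h.orthonormal hε (by linarith) heq hδ hδ' ?_ ?_
  · have e1 : τ * topWeight κ ε ≤ δ ^ 2 / 18 := by
      have := mul_le_mul_of_nonneg_left hτG (topWeight_nonneg κ ε)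
      linarith
    have e2 : τ * (topWeight κ ε * ACoef κ ε) ≤ δ ^ 2 / 18 * ACoef κ ε := by
      rw [← mul_assoc]; exact mul_le_mul_of_nonneg_right e1 hA0.le
    have e3 : δ ^ 2 * C₁ ≤ δ ^ 2 * ACoef κ ε := mul_le_mul_of_nonneg_left hA1.le (sq_nonneg _)
    linarith
  · have e1 : 4 / (δ ^ 2 * C₁) ≤ τ ^ 2 := by nlinarith
    rw [div_le_iff₀ (by positivity)] at e1
    have e3 : τ ^ 2 * (δ ^ 2 * C₁) ≤ τ ^ 2 * (δ ^ 2 * ACoef κ ε) :=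
      mul_le_mul_of_nonneg_left (mul_le_mul_of_nonneg_left hA1.le (sq_nonneg _)) (sq_nonneg _)
    linarith

theorem eventually_threshold_le (h : Regime φ κ r ω) {l : Filter ℝ} (hl : l ≤ 𝓝[>] 0)
    {x : ℝ → ℝ} (hx : IsTestFamily φ κ l x)
    (hx' : LogLevelNegligible φ κ l (fun ε : ℝ => ε ^ (-2 * ω)) x) {η : ℝ} (hη : 0 < η) :
    ∀ᶠ ε in l, x ε * √(2 * ACoef κ ε) ≤ η * ε ^ (-2 * ω) := by
  obtain ⟨C₁, h₁, C₂, hA⟩ := h.weights.A2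
  have hC₂ : 0 < C₂ := by linarith [(hA 1 one_pos).1, (hA 1 one_pos).2]
  have hsq : 0 < √(2 * C₂) := Real.sqrt_pos.2 (by linarith)
  set c : ℝ := η / √(2 * C₂) with hc
  have hc0 : 0 < c := by positivity
  have hbs := h.tendsto_topWeight_mul (p := 2 * ω) (f := fun ε => ε ^ (-2 * ω))
    (by simpa [neg_mul] using isBigO_refl (fun ε : ℝ => ε ^ (-2 * ω)) (𝓝[>] 0))
    (by linarith [h.two_omega_lt])
  have hlim := hx'.eventually (lt_mem_nhds (show -(c ^ 2 / 8) < 0 by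
    rw [neg_lt_zero]; positivity))
  filter_upwards [hl self_mem_nhdsWithin, hl (hbs.eventually
    (gt_mem_nhds (show 0 < 2 * C₁ / η by positivity))), hlim, hx] with ε hε hb hlog hlev
  have hε' : (0 : ℝ) < ε := hε
  set s : ℝ := ε ^ (-2 * ω) with hs
  have hs0 : 0 < s := Real.rpow_pos_of_pos hε' _
  have hsqA : √(2 * ACoef κ ε) ≤ √(2 * C₂) := Real.sqrt_le_sqrt (by linarith [(hA ε hε).2])
  have hcs : c * s * √(2 * ACoef κ ε) ≤ η * s := by
    have := mul_le_mul_of_nonneg_left hsqA (mul_pos hc0 hs0).le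
    refine this.trans (le_of_eq ?_)
    rw [hc]; field_simp
  by_contra hcon
  -- The tail bound is applied at `c s`, not at `x ε`, which may be too large for it; monotonicity
  -- of the level in the threshold covers the rest.
  have hxs : c * s < x ε := by
    by_contra hle
    exact hcon ((mul_le_mul_of_nonneg_right (not_lt.1 hle) (Real.sqrt_nonneg _)).trans hcs)
  have hα : typeI φ κ ε (x ε) ≤ Real.exp (-((c * s) ^ 2 / 8)) := by
    refine (typeI_anti h.weights hε' hxs.le).trans
      (typeI_le h.weights hε' (mul_pos hc0 hs0).le ?_)
    rw [lt_div_iff₀ hη] at hb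
    have := mul_le_mul_of_nonneg_right hcs (topWeight_nonneg κ ε)
    linarith [(hA ε hε).1]
  have h3 := Real.log_le_log hlev.1 hα
  rw [Real.log_exp] at h3
  have h4 : (s ^ 2)⁻¹ * Real.log (typeI φ κ ε (x ε)) ≤ (s ^ 2)⁻¹ * -((c * s) ^ 2 / 8) :=
    mul_le_mul_of_nonneg_left h3 (by positivity)
  have h5 : (s ^ 2)⁻¹ * -((c * s) ^ 2 / 8) = -(c ^ 2 / 8) := by field_simp
  rw [h5] at h4
  linarith

end Regime


theorem typeII_le_one (φ : ℕ → Signal) (κ : ℝ → ℕ → ℝ) (ε x : ℝ) (S : Signal) :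
    typeII φ κ ε x S ≤ 1 := by
  have : IsProbabilityMeasure (observationLaw φ ε S) := by
    unfold observationLaw; infer_instance
  exact measureReal_le_one

theorem abs_sub_le_of_two_sided_bounds {B L L' δ q : ℝ} (hB : 0 ≤ B) (hδ : 0 < δ)
    (hδ' : δ ≤ 1 / 2) (u : B * (1 - δ) ≤ L) (l : L ≤ B * (1 + 2 * δ) ^ 2)
    (hq : (1 - δ) ^ 2 * B ≤ q) (hq' : q ≤ (1 + δ) ^ 2 * B)
    (u' : q * (1 - δ) ≤ L') (l' : L' ≤ q * (1 + 2 * δ) ^ 2) :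
    |L' - L| ≤ 66 * δ * L := by
  have hδ2 : δ ^ 2 ≤ δ / 2 := by nlinarith
  have r1 : L' ≤ B * (1 + 30 * δ) := by
    have e1 := mul_le_mul_of_nonneg_right hq' (sq_nonneg (1 + 2 * δ))
    have e2 : (1 + δ) ^ 2 * (1 + 2 * δ) ^ 2 ≤ 1 + 30 * δ := by
      have e3 : (1 + δ) * (1 + 2 * δ) ≤ 1 + 4 * δ := by linarith
      rw [← mul_pow]
      have := pow_le_pow_left₀ (by positivity) e3 2
      linarith
    have e3 := mul_le_mul_of_nonneg_left e2 hB
    linarith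
  have r2 : B * (1 - 3 * δ) ≤ L' := by
    have e1 := mul_le_mul_of_nonneg_right hq (show 0 ≤ 1 - δ by linarith)
    have e2 : 1 - 3 * δ ≤ (1 - δ) ^ 2 * (1 - δ) := by nlinarith [sq_nonneg δ]
    have e3 := mul_le_mul_of_nonneg_left e2 hB
    linarith
  have r3 : L ≤ B * (1 + 30 * δ) := by
    refine l.trans (mul_le_mul_of_nonneg_left ?_ hB)
    linarith
  have r4 : B * δ ≤ 2 * (δ * L) := by
    have h1 : B * (1 / 2) ≤ B * (1 - δ) := mul_le_mul_of_nonneg_left (by linarith) hB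
    have := mul_le_mul_of_nonneg_left (h1.trans u) hδ.le
    linarith
  rw [abs_le]
  constructor <;> linarith

/-- The constant `66` is inherited from `abs_sub_le_of_two_sided_bounds`, so that both ranges of `τ`
end in the same estimate. -/
theorem abs_sub_le_of_mutual_bounds {L L' δ : ℝ} (hL : 0 ≤ L) (hδ : 0 < δ) (hδ' : δ ≤ 1 / 2)
    (h : L ≤ (1 + δ) * (L' + δ * L)) (h' : L' ≤ (1 + δ) * (L + δ * L)) :
    |L' - L| ≤ 66 * δ * L := by
  have d1 : 0 ≤ δ * L := mul_nonneg hδ.le hL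
  have d2 : δ * (δ * L) ≤ 1 / 2 * (δ * L) := mul_le_mul_of_nonneg_right hδ' d1
  have d3 : L' ≤ L + 3 * (δ * L) := by linarith
  have d4 := mul_le_mul_of_nonneg_left d3 hδ.le
  rw [abs_le]
  constructor <;> linarith

/-! ### Consistency expressed through `D_ε`, and stability under adding a signal. -/

namespace Regime

variable {φ : ℕ → Signal} {κ : ℝ → ℕ → ℝ} {r ω : ℝ} {S S₁ : ℝ → Signal}

theorem eventually_half_distance_le (h : Regime φ κ r ω)
    (hS : (fun ε => ‖S ε‖) =O[𝓝[>] 0] fun ε : ℝ => ε ^ (2 * r)) {p : ℝ} (hp : 2 * ω < p) :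
    ∀ᶠ ε in 𝓝[>] 0, (DCoef φ κ ε (S ε) - -ε ^ (-ω) * √(2 * ACoef κ ε)) / (2 * ACoef κ ε) ≤
      ε ^ (-p) := by
  obtain ⟨C₁, h₁, C₂, hA⟩ := h.weights.A2
  have hC₂ : 0 < C₂ := by linarith [(hA 1 one_pos).1, (hA 1 one_pos).2]
  have hω := h.omega_pos
  obtain ⟨C, hC0, hC⟩ := (h.DCoef_isBigO hS).exists_pos
  filter_upwards [self_mem_nhdsWithin, hC.bound,
    eventually_rpow_le_mul (a := -2 * ω) (b := -p) (by linarith) (c := C₁ / C) (by positivity),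
    eventually_rpow_le_mul (a := -ω) (b := -p) (by linarith) (c := C₁ / (√(2 * C₂) + 1))
      (by positivity)] with ε hε hD h1 h2
  have hε' : (0 : ℝ) < ε := hε
  have hAε := hA ε hε'
  have hA0 : 0 < ACoef κ ε := h₁.trans hAε.1
  have hp0 : 0 < ε ^ (-p) := Real.rpow_pos_of_pos hε' _
  have hω0 : 0 < ε ^ (-ω) := Real.rpow_pos_of_pos hε' _
  rw [Real.norm_of_nonneg (DCoef_nonneg _ _ _ _),
    Real.norm_of_nonneg (Real.rpow_pos_of_pos hε' _).le] at hD
  rw [div_le_iff₀ (by linarith)]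
  have e1 : C * ε ^ (-2 * ω) ≤ C₁ * ε ^ (-p) := by
    have := mul_le_mul_of_nonneg_left h1 hC0.le
    refine this.trans (le_of_eq ?_)
    field_simp
  have e2 : ε ^ (-ω) * √(2 * ACoef κ ε) ≤ C₁ * ε ^ (-p) := by
    have hsqA : √(2 * ACoef κ ε) ≤ √(2 * C₂) + 1 :=
      (Real.sqrt_le_sqrt (by linarith : 2 * ACoef κ ε ≤ 2 * C₂)).trans (by linarith)
    refine (mul_le_mul_of_nonneg_left hsqA hω0.le).trans ?_
    refine (mul_le_mul_of_nonneg_right h2 (by positivity)).trans (le_of_eq ?_)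
    field_simp
  have e3 : C₁ * ε ^ (-p) ≤ ACoef κ ε * ε ^ (-p) := mul_le_mul_of_nonneg_right hAε.1.le hp0.le
  linarith

/-- Consistent families have `D_ε(S_ε)` of order at least `ε^{-2ω}`. -/
theorem le_DCoef_of_consistent (h : Regime φ κ r ω)
    (hS : (fun ε => ‖S ε‖) =O[𝓝[>] 0] fun ε : ℝ => ε ^ (2 * r))
    (hcons : LDConsistent φ κ (fun ε : ℝ => ε ^ (-2 * ω)) S) :
    ∃ c > 0, ∀ᶠ ε in 𝓝[>] 0, c * ε ^ (-2 * ω) ≤ DCoef φ κ ε (S ε) := by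
  obtain ⟨C₁, h₁, C₂, hA⟩ := h.weights.A2
  have hC₂ : 0 < C₂ := by linarith [(hA 1 one_pos).1, (hA 1 one_pos).2]
  have hω := h.omega_pos
  have h2ω := h.two_omega_lt
  obtain ⟨p, hp1, hp2⟩ : ∃ p, 2 * ω < p ∧ p < 2 - 4 * r - 2 * ω :=
    exists_between (by linarith)
  have hG := h.tendsto_topWeight_mul (f := fun ε => ε ^ (-p)) (isBigO_refl _ _) hp2
  have h0 : (fun ε : ℝ => ‖(0 : ℝ → Signal) ε‖) =O[𝓝[>] 0] fun ε : ℝ => ε ^ (2 * r) := by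
    simp only [Pi.zero_apply, norm_zero]; exact isBigO_zero _ _
  obtain ⟨T, hT0, hT⟩ := h.eventually_le_typeII hS (δ := 1 / 2) (by norm_num) le_rfl hG
  obtain ⟨T₀, hT₀0, hT₀⟩ := h.eventually_le_typeII h0 (δ := 1 / 2) (by norm_num) le_rfl hG
  have hup := h.eventually_typeII_le h0 (δ := 1 / 2) (by norm_num)
  set sq₂ := √(2 * C₂) with hsq₂
  have hsq₂0 : 0 < sq₂ := Real.sqrt_pos.2 (by linarith)
  have hlarge : ∀ M : ℝ, ∀ (S' : ℝ → Signal), ∀ᶠ ε in 𝓝[>] 0,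
      M ≤ (DCoef φ κ ε (S' ε) - -ε ^ (-ω) * √(2 * ACoef κ ε)) / (2 * ACoef κ ε) := by
    intro M S'
    filter_upwards [self_mem_nhdsWithin,
      eventually_le_rpow_neg (a := -ω) (by linarith) (|M| * sq₂)] with ε hε hM
    have hε' : (0 : ℝ) < ε := hε
    have hA0 : 0 < ACoef κ ε := h₁.trans (hA ε hε').1
    rw [le_div_iff₀ (by linarith)]
    have e1 : √(2 * ACoef κ ε) ≤ sq₂ := Real.sqrt_le_sqrt (by linarith [(hA ε hε').2])
    have e2 : √(2 * ACoef κ ε) * √(2 * ACoef κ ε) = 2 * ACoef κ ε :=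
      Real.mul_self_sqrt (by linarith)
    have e3 : |M| * √(2 * ACoef κ ε) ≤ ε ^ (-ω) :=
      (mul_le_mul_of_nonneg_left e1 (abs_nonneg M)).trans hM
    have e4 := mul_le_mul_of_nonneg_right e3 (Real.sqrt_nonneg (2 * ACoef κ ε))
    rw [mul_assoc, e2] at e4
    have e5 : M * (2 * ACoef κ ε) ≤ |M| * (2 * ACoef κ ε) :=
      mul_le_mul_of_nonneg_right (le_abs_self M) (by linarith)
    linarith [DCoef_nonneg φ κ ε (S' ε)]
  have hnull : ∀ᶠ ε in 𝓝[>] 0, 0 < typeII φ κ ε (-ε ^ (-ω)) 0 ∧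
      typeII φ κ ε (-ε ^ (-ω)) 0 ≤ 1 / 2 := by
    filter_upwards [self_mem_nhdsWithin, hT₀, hup, hlarge T₀ 0, hlarge (2 / C₁ + 2) 0,
      h.eventually_half_distance_le h0 hp1] with ε hε hlow hupp hτT hτM hτG
    have hε' : (0 : ℝ) < ε := hε
    have hA1 := (hA ε hε').1
    have hA0 : 0 < ACoef κ ε := h₁.trans hA1
    set τ := (DCoef φ κ ε ((0 : ℝ → Signal) ε) - -ε ^ (-ω) * √(2 * ACoef κ ε)) /
      (2 * ACoef κ ε) with hτ
    have heq : DCoef φ κ ε ((0 : ℝ → Signal) ε) - -ε ^ (-ω) * √(2 * ACoef κ ε) =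
        2 * ACoef κ ε * τ := by rw [hτ]; field_simp
    refine ⟨(Real.exp_pos _).trans_le (hlow _ τ hτT hτG heq), ?_⟩
    refine (hupp _ τ (hT₀0.le.trans hτT) heq).trans ?_
    have hC : 0 < 2 / C₁ := by positivity
    have e1 : 2 / C₁ ≤ τ ^ 2 := by nlinarith
    rw [div_le_iff₀ h₁] at e1
    have e2 : 2 ≤ τ ^ 2 * ACoef κ ε :=
      e1.trans (mul_le_mul_of_nonneg_left hA1.le (sq_nonneg _))
    have e3 : (1 : ℝ) / 2 = Real.exp (-Real.log 2) := by
      rw [Real.exp_neg, Real.exp_log two_pos]; norm_num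
    refine le_trans (Real.exp_le_exp.2 ?_) e3.ge
    have := Real.log_two_lt_d9
    linarith
  -- The threshold `-ε^{-ω}` tends to `-∞`, so `τ` is large however small `D_ε` is and the lower
  -- bound for `β` applies; yet it is `o(ε^{-2ω})`, so it contributes negligibly to `2 A τ`. The
  -- level stays at least `1/2`, so its logarithm is bounded.
  have htest : IsTestFamily φ κ (𝓝[>] 0) fun ε => -ε ^ (-ω) := by
    filter_upwards [self_mem_nhdsWithin, hnull] with ε hε hn
    rw [typeI_eq_one_sub h.weights hε]
    constructor <;> linarith [hn.1, hn.2]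
  have hlev : LogLevelNegligible φ κ (𝓝[>] 0) (fun ε : ℝ => ε ^ (-2 * ω))
      fun ε => -ε ^ (-ω) := by
    have h4 : Tendsto (fun ε : ℝ => ε ^ (4 * ω) * Real.log 2) (𝓝[>] 0) (𝓝 0) := by
      simpa using (tendsto_rpow_zero (a := 4 * ω) (by linarith)).mul_const (Real.log 2)
    refine squeeze_zero_norm' ?_ h4
    filter_upwards [self_mem_nhdsWithin, hnull] with ε hε hn
    have hε' : (0 : ℝ) < ε := hε
    rw [typeI_eq_one_sub h.weights hε', norm_mul, norm_inv, norm_pow, ← Real.rpow_natCast,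
      Real.norm_of_nonneg (Real.rpow_pos_of_pos hε' _).le, ← Real.rpow_mul hε'.le,
      ← Real.rpow_neg hε'.le]
    have e1 : -(-2 * ω * ((2 : ℕ) : ℝ)) = 4 * ω := by push_cast; ring
    rw [e1]
    refine mul_le_mul_of_nonneg_left ?_ (Real.rpow_pos_of_pos hε' _).le
    have e2 : Real.log (1 - typeII φ κ ε (-ε ^ (-ω)) 0) ≤ 0 :=
      Real.log_nonpos (by linarith [hn.2]) (by linarith [hn.1])
    rw [Real.norm_eq_abs, abs_of_nonpos e2]
    have e3 : Real.log (1 / 2) ≤ Real.log (1 - typeII φ κ ε (-ε ^ (-ω)) 0) :=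
      Real.log_le_log (by norm_num) (by linarith [hn.2])
    rw [one_div, Real.log_inv] at e3
    linarith
  obtain ⟨c, hc, hev⟩ := hcons _ htest hlev
  refine ⟨√(c * C₁) / 2, by positivity, ?_⟩
  filter_upwards [self_mem_nhdsWithin, hev, hT, hlarge T S, h.eventually_half_distance_le hS hp1,
    eventually_rpow_le_mul (a := -ω) (b := -2 * ω) (by linarith)
      (c := √(c * C₁) / 2 / sq₂) (by positivity)] with ε hε hcε hlow hτT hτG hωs
  have hε' : (0 : ℝ) < ε := hε
  have hA1 := (hA ε hε').1
  have hA0 : 0 < ACoef κ ε := h₁.trans hA1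
  set τ := (DCoef φ κ ε (S ε) - -ε ^ (-ω) * √(2 * ACoef κ ε)) / (2 * ACoef κ ε) with hτ
  have heq : DCoef φ κ ε (S ε) - -ε ^ (-ω) * √(2 * ACoef κ ε) = 2 * ACoef κ ε * τ := by
    rw [hτ]; field_simp
  have hlow' := hlow _ τ hτT hτG heq
  have hτ0 : 0 < τ := hT0.trans_le hτT
  set s : ℝ := ε ^ (-2 * ω) with hs
  have hs0 : 0 < s := Real.rpow_pos_of_pos hε' _
  have e1 : |Real.log (typeII φ κ ε (-ε ^ (-ω)) (S ε))| ≤ 4 * (τ ^ 2 * ACoef κ ε) := by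
    have e2 := Real.log_le_log (Real.exp_pos _) hlow'
    rw [Real.log_exp] at e2
    have e3 : Real.log (typeII φ κ ε (-ε ^ (-ω)) (S ε)) ≤ 0 :=
      Real.log_nonpos (typeII_nonneg _ _) (typeII_le_one _ _ _ _ _)
    rw [abs_of_nonpos e3]
    linarith
  have e2 : c * s ^ 2 * C₁ ≤ (2 * ACoef κ ε * τ) ^ 2 := by
    have e3 : c * s ^ 2 ≤ 4 * (τ ^ 2 * ACoef κ ε) := hcε.trans e1
    calc c * s ^ 2 * C₁ ≤ 4 * (τ ^ 2 * ACoef κ ε) * ACoef κ ε := by gcongr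
      _ = _ := by ring
  have e3 : √(c * C₁) * s ≤ 2 * ACoef κ ε * τ := by
    refine le_of_sq_le_sq ?_ (by positivity)
    rw [mul_pow, Real.sq_sqrt (by positivity)]
    linarith
  have e4 : ε ^ (-ω) * √(2 * ACoef κ ε) ≤ √(c * C₁) / 2 * s := by
    have hsqA : √(2 * ACoef κ ε) ≤ sq₂ := Real.sqrt_le_sqrt (by linarith [(hA ε hε').2])
    refine (mul_le_mul hωs hsqA (Real.sqrt_nonneg _) (by positivity)).trans (le_of_eq ?_)
    field_simp
  linarith

/-- Inconsistent families have `D_ε(S_ε)` of smaller order than `ε^{-2ω}`. -/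
theorem DCoef_le_of_inconsistent (h : Regime φ κ r ω)
    (hS : (fun ε => ‖S ε‖) =O[𝓝[>] 0] fun ε : ℝ => ε ^ (2 * r))
    (hincons : LDInconsistent φ κ (fun ε : ℝ => ε ^ (-2 * ω)) S) {η : ℝ} (hη : 0 < η) :
    ∀ᶠ ε in 𝓝[>] 0, DCoef φ κ ε (S ε) ≤ η * ε ^ (-2 * ω) := by
  obtain ⟨C₁, h₁, C₂, hA⟩ := h.weights.A2
  have hC₂ : 0 < C₂ := by linarith [(hA 1 one_pos).1, (hA 1 one_pos).2]
  by_contra hcon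
  -- Failure of the bound yields a sequence with `D_ε > η ε^{-2ω}`. Along it admissible thresholds
  -- take at most half of this, so the Chernoff bound makes the family consistent there.
  obtain ⟨u, hu, hlarge⟩ := exists_seq_forall_of_frequently (not_eventually.1 hcon)
  refine hincons u hu fun x hx hx' => ⟨η ^ 2 / (32 * C₂), by positivity, ?_⟩
  have hl : map u atTop ≤ 𝓝[>] 0 := hu
  filter_upwards [hl self_mem_nhdsWithin,
    h.eventually_threshold_le hl hx hx' (half_pos hη), hx,
    hl (h.eventually_typeII_le hS (δ := 1 / 2) (by norm_num)),
    (eventually_map (P := fun ε => ¬DCoef φ κ ε (S ε) ≤ η * ε ^ (-2 * ω))).2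
      (Eventually.of_forall hlarge)] with ε hε hthr hlev hup hD
  have hε' : (0 : ℝ) < ε := hε
  have hA0 : 0 < ACoef κ ε := h₁.trans (hA ε hε').1
  set s : ℝ := ε ^ (-2 * ω) with hs
  have hs0 : 0 < s := Real.rpow_pos_of_pos hε' _
  set τ := (DCoef φ κ ε (S ε) - x ε * √(2 * ACoef κ ε)) / (2 * ACoef κ ε) with hτ
  have heq : DCoef φ κ ε (S ε) - x ε * √(2 * ACoef κ ε) = 2 * ACoef κ ε * τ := by
    rw [hτ]; field_simp
  have hge : η / 2 * s ≤ 2 * ACoef κ ε * τ := by linarith [not_le.1 hD]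
  have hτ0 : 0 ≤ τ := by
    have : 0 < 2 * ACoef κ ε * τ := lt_of_lt_of_le (by positivity) hge
    exact (pos_of_mul_pos_right this (by linarith)).le
  have e1 := Real.log_le_log (typeII_pos h.weights h.orthonormal hε' hlev.2 (S ε))
    (hup _ τ hτ0 heq)
  rw [Real.log_exp] at e1
  refine le_trans ?_ (neg_le_abs _)
  have e2 : (η / 2 * s) ^ 2 ≤ (2 * ACoef κ ε * τ) ^ 2 := pow_le_pow_left₀ (by positivity) hge 2
  have e3 : τ ^ 2 * ACoef κ ε = (2 * ACoef κ ε * τ) ^ 2 / (4 * ACoef κ ε) := by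
    field_simp; ring
  have e4 : (η / 2 * s) ^ 2 / (4 * C₂) ≤ τ ^ 2 * ACoef κ ε := by
    rw [e3]
    exact div_le_div₀ (sq_nonneg _) e2 (by linarith) (by linarith [(hA ε hε').2])
  have e5 : η ^ 2 / (32 * C₂) * s ^ 2 = (η / 2 * s) ^ 2 / (4 * C₂) * (1 / 2) := by
    field_simp; ring
  rw [e5]
  linarith

theorem norm_add_isBigO (hS : (fun ε => ‖S ε‖) =O[𝓝[>] 0] fun ε : ℝ => ε ^ (2 * r))
    (hS₁ : (fun ε => ‖S₁ ε‖) =O[𝓝[>] 0] fun ε : ℝ => ε ^ (2 * r)) :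
    (fun ε => ‖S ε + S₁ ε‖) =O[𝓝[>] 0] fun ε : ℝ => ε ^ (2 * r) :=
  IsBigO.trans (IsBigO.of_bound' (Eventually.of_forall fun ε => by
    rw [norm_norm, Real.norm_of_nonneg (by positivity)]
    exact norm_add_le _ _)) (hS.add hS₁)

/-- Adding signals with small `D_ε` does not change `D_ε` relatively. -/
theorem eventually_abs_DCoef_add_sub_le (h : Regime φ κ r ω)
    (hS : (fun ε => ‖S ε‖) =O[𝓝[>] 0] fun ε : ℝ => ε ^ (2 * r))
    (hD₁ : ∀ η > 0, ∀ᶠ ε in 𝓝[>] 0, DCoef φ κ ε (S₁ ε) ≤ η * ε ^ (-2 * ω))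
    {η : ℝ} (hη : 0 < η) :
    ∀ᶠ ε in 𝓝[>] 0, |DCoef φ κ ε (S ε + S₁ ε) - DCoef φ κ ε (S ε)| ≤ η * ε ^ (-2 * ω) := by
  obtain ⟨C, hC0, hC⟩ := (h.DCoef_isBigO hS).exists_pos
  -- Young's parameter, chosen so that `a * C = η / 2`; the large factor `1 + a⁻¹` is harmless
  -- because `D_ε(S₁)` is below any multiple of `ε^{-2ω}`.
  set a : ℝ := η / (2 * C) with ha
  have ha0 : 0 < a := by positivity
  filter_upwards [self_mem_nhdsWithin, hC.bound,
    hD₁ (η / (2 * (1 + a⁻¹))) (by positivity)] with ε hε hD hD1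
  have hε' : (0 : ℝ) < ε := hε
  rw [Real.norm_of_nonneg (DCoef_nonneg _ _ _ _),
    Real.norm_of_nonneg (Real.rpow_pos_of_pos hε' _).le] at hD
  refine (h.weights.abs_DCoef_add_sub_le h.orthonormal hε' (S ε) (S₁ ε) ha0).trans ?_
  have e1 := mul_le_mul_of_nonneg_left hD ha0.le
  have e2 := mul_le_mul_of_nonneg_left hD1 (show 0 ≤ 1 + a⁻¹ by positivity)
  have e3 : a * (C * ε ^ (-2 * ω)) = η / 2 * ε ^ (-2 * ω) := by rw [ha]; field_simp
  have e4 : (1 + a⁻¹) * (η / (2 * (1 + a⁻¹)) * ε ^ (-2 * ω)) = η / 2 * ε ^ (-2 * ω) := by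
    field_simp
  linarith

/-- If the threshold stays below `D_ε` by the order `ε^{-2ω}`, the logarithms of the type II error
probabilities at `S` and `S + S₁` are close. -/
theorem eventually_abs_log_typeII_sub_le (h : Regime φ κ r ω)
    (hS : (fun ε => ‖S ε‖) =O[𝓝[>] 0] fun ε : ℝ => ε ^ (2 * r))
    (hS₁ : (fun ε => ‖S₁ ε‖) =O[𝓝[>] 0] fun ε : ℝ => ε ^ (2 * r))
    (hD₁ : ∀ η > 0, ∀ᶠ ε in 𝓝[>] 0, DCoef φ κ ε (S₁ ε) ≤ η * ε ^ (-2 * ω))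
    {x : ℝ → ℝ} (hx : IsTestFamily φ κ (𝓝[>] 0) x) {c : ℝ} (hc : 0 < c)
    (hgap : ∀ᶠ ε in 𝓝[>] 0,
      c * ε ^ (-2 * ω) ≤ DCoef φ κ ε (S ε) - x ε * √(2 * ACoef κ ε))
    {δ : ℝ} (hδ : 0 < δ) (hδ' : δ ≤ 1 / 2) :
    ∀ᶠ ε in 𝓝[>] 0, 0 < -Real.log (typeII φ κ ε (x ε) (S ε)) ∧
      |Real.log (typeII φ κ ε (x ε) (S ε)) - Real.log (typeII φ κ ε (x ε) (S ε + S₁ ε))| ≤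
        66 * δ * -Real.log (typeII φ κ ε (x ε) (S ε)) := by
  obtain ⟨C₁, h₁, C₂, hA⟩ := h.weights.A2
  have hC₂ : 0 < C₂ := by linarith [(hA 1 one_pos).1, (hA 1 one_pos).2]
  have hω := h.omega_pos
  have h2ω := h.two_omega_lt
  -- The upper limit keeps `topWeight * ε^{-p}` vanishing; the lower one makes `ε^{-2p}` dominate
  -- the squared signal-to-noise ratio `ε^{4r-2}`. The factor `2` in `hG` leaves room for `τ' ≤
  -- 3τ/2`.
  obtain ⟨p, hp1, hp2⟩ : ∃ p, 1 - 2 * r < p ∧ p < 2 - 4 * r - 2 * ω :=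
    exists_between (by linarith)
  have hG : Tendsto (fun ε => topWeight κ ε * (2 * ε ^ (-p))) (𝓝[>] 0) (𝓝 0) :=
    h.tendsto_topWeight_mul ((isBigO_refl _ _).const_mul_left 2) hp2
  have hS' : (fun ε => ‖(S + S₁) ε‖) =O[𝓝[>] 0] fun ε : ℝ => ε ^ (2 * r) :=
    norm_add_isBigO hS hS₁
  obtain ⟨T, hT0, hT⟩ := h.eventually_le_typeII hS hδ hδ' hG
  obtain ⟨T', hT'0, hT'⟩ := h.eventually_le_typeII hS' hδ hδ' hG
  obtain ⟨C, hC0, hC⟩ := (normSq_isBigO hS₁).exists_pos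
  filter_upwards [self_mem_nhdsWithin, hx, hgap, hT, hT', h.eventually_typeII_le hS hδ,
    h.eventually_typeII_le hS' hδ, hC.bound,
    h.eventually_abs_DCoef_add_sub_le hS hD₁ (mul_pos hδ hc),
    eventually_rpow_le_mul (a := 4 * r - 2) (b := -(2 * p)) (by linarith)
      (c := δ ^ 2 * C₁ / C) (by positivity),
    eventually_le_rpow_neg (a := -2 * ω) (by linarith) (2 * C₂ / c * (T + 2 * T'))]
    with ε hε hlev hgapε hlow hlow' hup hup' hN hDD hNp hlarge
  have hε' : (0 : ℝ) < ε := hε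
  have hAε := hA ε hε'
  have hA0 : 0 < ACoef κ ε := h₁.trans hAε.1
  set s : ℝ := ε ^ (-2 * ω) with hs
  have hs0 : 0 < s := Real.rpow_pos_of_pos hε' _
  set H : ℝ := ε ^ (-p) with hH
  have hH0 : 0 < H := Real.rpow_pos_of_pos hε' _
  set D := DCoef φ κ ε (S ε) with hDdef
  have hpos := typeII_pos h.weights h.orthonormal hε' hlev.2 (S ε)
  have hpos' := typeII_pos h.weights h.orthonormal hε' hlev.2 (S ε + S₁ ε)
  set τ := (D - x ε * √(2 * ACoef κ ε)) / (2 * ACoef κ ε) with hτ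
  have heq : D - x ε * √(2 * ACoef κ ε) = 2 * ACoef κ ε * τ := by rw [hτ]; field_simp
  set τ' := (DCoef φ κ ε ((S + S₁) ε) - x ε * √(2 * ACoef κ ε)) / (2 * ACoef κ ε) with hτ'
  have heq' : DCoef φ κ ε ((S + S₁) ε) - x ε * √(2 * ACoef κ ε) = 2 * ACoef κ ε * τ' := by
    rw [hτ']; field_simp
  have hcs : c * s ≤ 2 * ACoef κ ε * τ := heq ▸ hgapε
  have hτ0 : 0 < τ :=
    pos_of_mul_pos_right (lt_of_lt_of_le (mul_pos hc hs0) hcs) (by linarith)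
  -- The doubled `T'` ensures `τ' ≥ T'`, since `τ' ≥ τ/2`.
  have hτT : T + 2 * T' ≤ τ := by
    have e1 : c * (2 * C₂ / c * (T + 2 * T')) ≤ c * s := mul_le_mul_of_nonneg_left hlarge hc.le
    have e2 : c * (2 * C₂ / c * (T + 2 * T')) = 2 * C₂ * (T + 2 * T') := by field_simp
    have e3 : 2 * ACoef κ ε * τ ≤ 2 * C₂ * τ :=
      mul_le_mul_of_nonneg_right (by linarith) hτ0.le
    exact le_of_mul_le_mul_left (by linarith) (show 0 < 2 * C₂ by linarith)
  have hττ : |τ' - τ| ≤ δ * τ := by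
    have e1 : DCoef φ κ ε (S ε + S₁ ε) - D = 2 * ACoef κ ε * (τ' - τ) := by
      have : DCoef φ κ ε ((S + S₁) ε) = DCoef φ κ ε (S ε + S₁ ε) := rfl
      linarith
    rw [e1, abs_mul, abs_of_pos (by linarith)] at hDD
    have e2 := mul_le_mul_of_nonneg_left hcs hδ.le
    exact le_of_mul_le_mul_left (by linarith) (show 0 < 2 * ACoef κ ε by linarith)
  obtain ⟨hτa, hτb⟩ := abs_le.1 hττ
  have hδτ : δ * τ ≤ 1 / 2 * τ := mul_le_mul_of_nonneg_right hδ' hτ0.le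
  set B : ℝ := τ ^ 2 * ACoef κ ε with hB
  have hB0 : 0 < B := by positivity
  have u1 : B * (1 - δ) ≤ -Real.log (typeII φ κ ε (x ε) (S ε)) := by
    have := Real.log_le_log hpos (hup _ τ hτ0.le heq)
    rw [Real.log_exp] at this
    linarith
  have hBδ : B * (1 / 2) ≤ B * (1 - δ) := mul_le_mul_of_nonneg_left (by linarith) hB0.le
  set L := -Real.log (typeII φ κ ε (x ε) (S ε)) with hL
  set L' := -Real.log (typeII φ κ ε (x ε) (S ε + S₁ ε)) with hL'
  have hL0 : 0 < L := by linarith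
  refine ⟨hL0, ?_⟩
  have hdiff : Real.log (typeII φ κ ε (x ε) (S ε)) -
      Real.log (typeII φ κ ε (x ε) (S ε + S₁ ε)) = L' - L := by rw [hL, hL']; ring
  rw [hdiff]
  -- Below `H` the two-sided tail bounds apply to both signals. Above it, `L ≥ B/2` is so large that
  -- the cost of shifting the Gaussian mean is at most `δ L`, and the shift inequality is used in
  -- both directions.
  rcases le_or_gt τ H with hcase | hcase
  · have l1 : L ≤ B * (1 + 2 * δ) ^ 2 := by
      have := Real.log_le_log (Real.exp_pos _) (hlow _ τ (by linarith) (by linarith) heq)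
      rw [Real.log_exp] at this
      linarith
    have hτ'0 : 0 ≤ τ' := by linarith
    have l2 : L' ≤ τ' ^ 2 * ACoef κ ε * (1 + 2 * δ) ^ 2 := by
      have := Real.log_le_log (Real.exp_pos _) (hlow' _ τ' (by linarith) (by linarith) heq')
      rw [Real.log_exp] at this
      have e : (S + S₁) ε = S ε + S₁ ε := rfl
      rw [e] at this
      linarith
    have u2 : τ' ^ 2 * ACoef κ ε * (1 - δ) ≤ L' := by
      have := Real.log_le_log hpos' (hup' _ τ' hτ'0 heq')
      rw [Real.log_exp] at this
      linarith
    have q1 : τ' ^ 2 * ACoef κ ε ≤ (1 + δ) ^ 2 * B := by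
      have : τ' ^ 2 ≤ ((1 + δ) * τ) ^ 2 := pow_le_pow_left₀ hτ'0 (by linarith) 2
      calc τ' ^ 2 * ACoef κ ε ≤ ((1 + δ) * τ) ^ 2 * ACoef κ ε :=
            mul_le_mul_of_nonneg_right this hA0.le
        _ = _ := by rw [hB]; ring
    have q2 : (1 - δ) ^ 2 * B ≤ τ' ^ 2 * ACoef κ ε := by
      have : ((1 - δ) * τ) ^ 2 ≤ τ' ^ 2 :=
        pow_le_pow_left₀ (mul_nonneg (by linarith) hτ0.le) (by linarith) 2
      calc _ = ((1 - δ) * τ) ^ 2 * ACoef κ ε := by rw [hB]; ring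
        _ ≤ _ := mul_le_mul_of_nonneg_right this hA0.le
    exact abs_sub_le_of_two_sided_bounds hB0.le hδ hδ' u1 l1 q2 q1 u2 l2
  · have hBH : H ^ 2 * C₁ ≤ B := by
      rw [hB]
      exact mul_le_mul (pow_le_pow_left₀ hH0.le hcase.le 2) hAε.1.le h₁.le (sq_nonneg _)
    have hNL : ‖S₁ ε‖ ^ 2 * (ε ^ 2)⁻¹ / (2 * δ) ≤ δ * L := by
      rw [Real.norm_of_nonneg (by positivity),
        Real.norm_of_nonneg (Real.rpow_pos_of_pos hε' _).le] at hN
      have e1 : ε ^ (-(2 * p)) = H ^ 2 := by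
        rw [hH, ← Real.rpow_natCast, ← Real.rpow_mul hε'.le]
        congr 1; push_cast; ring
      rw [e1] at hNp
      have e2 := mul_le_mul_of_nonneg_left hNp hC0.le
      have e3 : C * (δ ^ 2 * C₁ / C * H ^ 2) = δ ^ 2 * (H ^ 2 * C₁) := by field_simp
      have e4 : δ ^ 2 * (H ^ 2 * C₁) ≤ δ ^ 2 * (2 * L) :=
        mul_le_mul_of_nonneg_left (by linarith) (sq_nonneg _)
      rw [div_le_iff₀ (by positivity)]
      linarith
    have s1 := neg_log_typeII_shift_le h.weights h.orthonormal hε' hlev.2 (S ε) (S ε + S₁ ε) hδ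
    have s2 := neg_log_typeII_shift_le h.weights h.orthonormal hε' hlev.2 (S ε + S₁ ε) (S ε) hδ
    rw [add_sub_cancel_left] at s1
    rw [sub_add_cancel_left, norm_neg] at s2
    rw [← hL, ← hL'] at s1 s2
    have s1' : L ≤ (1 + δ) * (L' + δ * L) :=
      s1.trans (mul_le_mul_of_nonneg_left (by linarith) (by linarith))
    have s2' : L' ≤ (1 + δ) * (L + δ * L) :=
      s2.trans (mul_le_mul_of_nonneg_left (by linarith) (by linarith))
    exact abs_sub_le_of_mutual_bounds hL0.le hδ hδ' s1' s2'

end Regime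

end SignalDetection
-- The main theorem.
open SignalDetection in
theorem mainTheorem8
    (φ : ℕ → Signal) (hφ : Orthonormal ℝ φ)
    (κ : ℝ → ℕ → ℝ) (hκ : WeightConditions κ)
    (r ω : ℝ) (hr : 0 < r) (hr' : r < 1 / 2) (hω : 0 < 2 * ω) (hω' : 2 * ω < 1 - 2 * r)
    (hk : (fun ε : ℝ => (kIndex κ ε : ℝ)) =Θ[𝓝[>] 0] fun ε : ℝ => ε ^ (-4 + 8 * r + 4 * ω))
    (S S₁ : ℝ → Signal)
    (hS : (fun ε : ℝ => ‖S ε‖) =Θ[𝓝[>] 0] fun ε : ℝ => ε ^ (2 * r))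
    (hS₁ : (fun ε : ℝ => ‖S₁ ε‖) =Θ[𝓝[>] 0] fun ε : ℝ => ε ^ (2 * r))
    (hcons : LDConsistent φ κ (fun ε : ℝ => ε ^ (-2 * ω)) S)
    (hincons : LDInconsistent φ κ (fun ε : ℝ => ε ^ (-2 * ω)) S₁)
    (x : ℝ → ℝ) (hx : IsTestFamily φ κ (𝓝[>] 0) x)
    (hx' : LogLevelNegligible φ κ (𝓝[>] 0) (fun ε : ℝ => ε ^ (-2 * ω)) x ∨
      ∃ c > 0, ∀ᶠ ε in 𝓝[>] (0 : ℝ),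
        c * BCoef φ κ ε (S ε) ≤ BCoef φ κ ε (S ε) - x ε) :
    Tendsto
      (fun ε : ℝ =>
        (Real.log (typeII φ κ ε (x ε) (S ε)) - Real.log (typeII φ κ ε (x ε) (S ε + S₁ ε))) /
          Real.log (typeII φ κ ε (x ε) (S ε)))
      (𝓝[>] 0) (𝓝 0) := by
  have h : Regime φ κ r ω := ⟨hφ, hκ, by linarith, hω', hκ.topWeight_isBigO hk⟩
  obtain ⟨c₀, hc₀, hD⟩ := h.le_DCoef_of_consistent hS.1 hcons
  have hD₁ : ∀ η > 0, ∀ᶠ ε in 𝓝[>] 0, DCoef φ κ ε (S₁ ε) ≤ η * ε ^ (-2 * ω) :=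
    fun η hη => h.DCoef_le_of_inconsistent hS₁.1 hincons hη
  -- Both alternatives for the test reduce to one gap condition: a negligible log-level bounds the
  -- threshold by `(c₀/2) ε^{-2ω}`, while the second alternative becomes the gap after
  -- multiplication by `√(2 A_ε)`.
  have hgap : ∃ c > 0, ∀ᶠ ε in 𝓝[>] (0 : ℝ),
      c * ε ^ (-2 * ω) ≤ DCoef φ κ ε (S ε) - x ε * √(2 * ACoef κ ε) := by
    rcases hx' with hx' | ⟨c, hc, hx'⟩
    · refine ⟨c₀ / 2, half_pos hc₀, ?_⟩
      filter_upwards [hD, h.eventually_threshold_le le_rfl hx hx' (half_pos hc₀)] with ε h1 h2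
      linarith
    · refine ⟨c * c₀, mul_pos hc hc₀, ?_⟩
      filter_upwards [hD, hx', self_mem_nhdsWithin] with ε h1 h2 hε
      have hA := hκ.ACoef_pos hε
      have hsq : 0 < √(2 * ACoef κ ε) := Real.sqrt_pos.2 (by linarith)
      have h3 := mul_le_mul_of_nonneg_right h2 hsq.le
      have h4 : BCoef φ κ ε (S ε) * √(2 * ACoef κ ε) = DCoef φ κ ε (S ε) := by
        rw [BCoef]; field_simp
      rw [sub_mul, mul_assoc, h4] at h3
      have h5 := mul_le_mul_of_nonneg_left h1 hc.le
      linarith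
  obtain ⟨c, hc, hgap⟩ := hgap
  rw [Metric.tendsto_nhds]
  intro η hη
  -- `67` exceeds the constant `66` of the comparison, so `66 δ < η` strictly.
  have hδ : 0 < min (1 / 2) (η / 67) := lt_min (by norm_num) (by positivity)
  filter_upwards [h.eventually_abs_log_typeII_sub_le hS.1 hS₁.1 hD₁ hx hc hgap hδ
    (min_le_left _ _)] with ε ⟨hL, hle⟩
  rw [dist_zero_right, norm_div, Real.norm_eq_abs, Real.norm_eq_abs,
    abs_of_neg (neg_pos.1 hL), div_lt_iff₀ hL]
  refine hle.trans_lt (mul_lt_mul_of_pos_right ?_ hL)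
  have := min_le_right (1 / 2) (η / 67)
  linarith
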